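/- Consider the planar Newtonian three-body problem with equal masses $m>0$ (gravitational constant $1$), $$\ddot q_i=\sum_{j\neq i}\frac{m\,(q_j-q_i)}{|q_j-q_i|^3},\qquad q_i(t)\in\mathbb{R}^2,\quad i=1,2,3,$$ and let $q=(q_1,q_2,q_3)$ be a collision-free solution on an open time interval $I$. Call $q$ a relative equilibrium if all three mutual distances $r_{ij}(t)=|q_i(t)-q_j(t)|$ are constant on $I$, and partially rigid if at least one, but not all, of the three mutual distances is constant on $I$. Then $q$ is not partially rigid. In other words, if at least one of the three mutual distances is constant on $I$, then all three are constant and $q$ is one of Lagrange's relative equilibrium solutions: there are $a,b\in\mathbb{R}^2$, $\omega\in\mathbb{R}$ and a configuration $p_1,p_2,p_3\in\mathbb{R}^2$ with $p_1+p_2+p_3=0$ such that $$q_i(t)=a+tb+R(\omega t)\,p_i\qquad (t\in I,\ i=1,2,3),$$ where $R(\theta)$ is the rotation by the angle $\theta$, and the points $p_1,p_2,p_3$ either form a nondegenerate equilateral triangle or are such that one of them is the midpoint of the other two, which are distinct. -/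

import Mathlib

/-- `q` is a (collision-free, classical) solution on the time set `I` of the Newtonian `n`-body
problem in `E` with masses `m` and gravitational constant `1`:
`q_i'' = ∑_{j ≠ i} m_j (q_j - q_i) / |q_j - q_i|³`. It is used for open intervals `I`. -/
structure IsNBodySolution {ι E : Type*} [Fintype ι] [DecidableEq ι] [NormedAddCommGroup E]
    [InnerProductSpace ℝ E] (m : ι → ℝ) (I : Set ℝ) (q : ι → ℝ → E) : Prop where
  no_collision : ∀ t ∈ I, ∀ i j, i ≠ j → q i t ≠ q j t
  newton : ∃ v : ι → ℝ → E, ∀ t ∈ I, ∀ i,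
    HasDerivAt (q i) (v i t) t ∧
    HasDerivAt (v i)
      (∑ j ∈ Finset.univ.erase i, (m j / ‖q j t - q i t‖ ^ 3) • (q j t - q i t)) t

/-- The mutual distance of the bodies `i` and `j` is constant on `I`. -/
def HasConstantDistance {ι E : Type*} [NormedAddCommGroup E]
    (I : Set ℝ) (q : ι → ℝ → E) (i j : ι) : Prop :=
  ∃ c : ℝ, ∀ t ∈ I, dist (q i t) (q j t) = c

/-- All mutual distances are constant on `I`. -/
def IsRelativeEquilibrium {ι E : Type*} [NormedAddCommGroup E]
    (I : Set ℝ) (q : ι → ℝ → E) : Prop :=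
  ∀ i j, i ≠ j → HasConstantDistance I q i j

/-- At least one, but not all, of the mutual distances is constant on `I`. -/
def IsPartiallyRigid {ι E : Type*} [NormedAddCommGroup E]
    (I : Set ℝ) (q : ι → ℝ → E) : Prop :=
  (∃ i j, i ≠ j ∧ HasConstantDistance I q i j) ∧ ¬ IsRelativeEquilibrium I q

/-- Rotation of the Euclidean plane by the angle `θ`. -/
noncomputable def planeRotation (θ : ℝ) (p : EuclideanSpace ℝ (Fin 2)) :
    EuclideanSpace ℝ (Fin 2) :=
  !₂[Real.cos θ * p 0 - Real.sin θ * p 1, Real.sin θ * p 0 + Real.cos θ * p 1]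

/-- The three points are the vertices of a (nondegenerate) equilateral triangle. -/
def IsEquilateral (p : Fin 3 → EuclideanSpace ℝ (Fin 2)) : Prop :=
  ∃ s : ℝ, 0 < s ∧ ∀ i j, i ≠ j → dist (p i) (p j) = s

/-- One of the three points is the midpoint of the two others, which are distinct: the collinear
shape of a relative equilibrium of three equal masses. -/
def IsSymmetricCollinear (p : Fin 3 → EuclideanSpace ℝ (Fin 2)) : Prop :=
  ∃ i j k : Fin 3, i ≠ j ∧ i ≠ k ∧ p j ≠ p k ∧ p i = midpoint ℝ (p j) (p k)

/-- The motion `q` of three equal masses in the plane has on `I` the form of Lagrange's relative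
equilibria: seen from the uniformly moving centre of mass `a + t b`, a configuration `p`, either an
equilateral triangle or collinear with one body midway between the others, rotates uniformly. -/
def IsLagrangeMotion (I : Set ℝ) (q : Fin 3 → ℝ → EuclideanSpace ℝ (Fin 2)) : Prop :=
  ∃ (a b : EuclideanSpace ℝ (Fin 2)) (ω : ℝ) (p : Fin 3 → EuclideanSpace ℝ (Fin 2)),
    ∑ i, p i = 0 ∧ (IsEquilateral p ∨ IsSymmetricCollinear p) ∧
    ∀ t ∈ I, ∀ i, q i t = a + t • b + planeRotation (ω * t) (p i)

/-! In the rotating, rescaled frame where the rigid pair rests at `1` and `-1`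
(`exists_isRigidPairMotion`), the third body has position `z` and inertial velocity `p`, and the
frame has angular velocity `w`. Besides the equations of motion, angular momentum and energy,
rigidity gives a constraint: `w ^ 2` is an explicit function of `z`. Differentiating it gives one
more relation (`IsRigidPairMotion.rigidity_deriv`). All of this is algebraic in `z`, `p`, their
conjugates, `w` and the two distances to the third body.

The point is that `z` is constant (`exists_z_eq`). Otherwise `z` has infinitely many values on the
interval, and along a suitable ultrafilter its germ is not a constant. The germs form a field `K` in
which `ℂ` is integrally closed, because it is algebraically closed. So some valuation ring `V` of
`K` contains the constants but not `z` (`exists_place_of_infinite_image`): a place where `z` is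
infinite. There the conjugate of `z` is an independent quantity, finite or infinite.

Every such place is excluded by the leading terms of the relations (`z_fst_mem`). Far from the pair
the forces die out, so `w ^ 2` tends to the nonzero constant `κ`, and the two integrals control the
velocities. The differentiated constraint then becomes an equation between residues, which the
derivatives forced by the equations of motion violate. This needs the first derivative of that
equation too, so 1-jets (dual numbers) are specialized. No derivation on `K` is needed: jets are
formed for functions and then mapped to `K`, and each derivative is shown finite through the
equations of motion. The exceptional places have the conjugate of `z` tending to `1` or `-1`, where
one force may survive.

Once `z` is constant, `w` is too, and the equations for rest leave Euler's positions `0`, `3`, `-3`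
or Lagrange's triangle (`eq_of_rest`). -/

section RigidPairs

open TrivSqZeroExt

/-! ### Numerals in dual numbers -/

section DualNumber

variable {R : Type*} [CommRing R]

@[simp]
theorem DualNumber.fst_ofNat (n : ℕ) [n.AtLeastTwo] :
    fst (ofNat(n) : DualNumber R) = OfNat.ofNat n :=
  map_ofNat (fstHom R R R) n

@[simp]
theorem DualNumber.snd_ofNat (n : ℕ) [n.AtLeastTwo] :
    snd (ofNat(n) : DualNumber R) = 0 :=
  snd_natCast n

end DualNumber

/-! ### Residues of field elements and of dual numbers at a place -/

section Specialization

variable {K : Type*} [Field K] (V : ValuationSubring K)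

/-- `x` lies in the valuation ring `V` and its residue is `y`. -/
def SpecializesTo (x : K) (y : IsLocalRing.ResidueField V) : Prop :=
  ∃ h : x ∈ V, IsLocalRing.residue V ⟨x, h⟩ = y

variable {V} {x x' : K} {y y' : IsLocalRing.ResidueField V}

namespace SpecializesTo

theorem add (h : SpecializesTo V x y) (h' : SpecializesTo V x' y') :
    SpecializesTo V (x + x') (y + y') := by
  obtain ⟨h, rfl⟩ := h
  obtain ⟨h', rfl⟩ := h'
  exact ⟨V.add_mem _ _ h h', by rw [← map_add]; rfl⟩

theorem mul (h : SpecializesTo V x y) (h' : SpecializesTo V x' y') :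
    SpecializesTo V (x * x') (y * y') := by
  obtain ⟨h, rfl⟩ := h
  obtain ⟨h', rfl⟩ := h'
  exact ⟨V.mul_mem _ _ h h', by rw [← map_mul]; rfl⟩

theorem neg (h : SpecializesTo V x y) : SpecializesTo V (-x) (-y) := by
  obtain ⟨h, rfl⟩ := h
  exact ⟨V.neg_mem _ h, by rw [← map_neg]; rfl⟩

theorem sub (h : SpecializesTo V x y) (h' : SpecializesTo V x' y') :
    SpecializesTo V (x - x') (y - y') := by
  rw [sub_eq_add_neg, sub_eq_add_neg]; exact h.add h'.neg

theorem zero : SpecializesTo V 0 0 := ⟨V.zero_mem, map_zero (IsLocalRing.residue V)⟩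

theorem one : SpecializesTo V 1 1 := ⟨V.one_mem, map_one (IsLocalRing.residue V)⟩

theorem natCast (n : ℕ) : SpecializesTo V n n := by
  induction n with
  | zero => simpa using zero
  | succ n ih => simpa using ih.add one

theorem ofNat (n : ℕ) [n.AtLeastTwo] : SpecializesTo V (OfNat.ofNat n) (OfNat.ofNat n) :=
  natCast n

theorem pow (h : SpecializesTo V x y) (n : ℕ) : SpecializesTo V (x ^ n) (y ^ n) := by
  induction n with
  | zero => simpa using one
  | succ n ih => simpa [pow_succ] using ih.mul h

theorem unique (h : SpecializesTo V x y) (h' : SpecializesTo V x y') : y = y' := by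
  obtain ⟨h, rfl⟩ := h
  obtain ⟨h', rfl⟩ := h'
  rfl

theorem congr (h : SpecializesTo V x y) (hx : x = x') (hy : y = y') : SpecializesTo V x' y' :=
  hx ▸ hy ▸ h

theorem ne_zero (h : SpecializesTo V x y) (hy : y ≠ 0) : x ≠ 0 := by
  rintro rfl
  exact hy (h.unique zero)

theorem inv (h : SpecializesTo V x y) (hy : y ≠ 0) : SpecializesTo V x⁻¹ y⁻¹ := by
  have hx := h.ne_zero hy
  obtain ⟨h, rfl⟩ := h
  have hu : IsUnit (⟨x, h⟩ : V) := by
    by_contra hu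
    exact hy ((IsLocalRing.residue_eq_zero_iff _).2 hu)
  obtain ⟨⟨u, hu1⟩, hu2⟩ := hu.exists_right_inv
  have hxu : x * u = 1 := congrArg Subtype.val hu2
  obtain rfl : u = x⁻¹ := eq_inv_of_mul_eq_one_right hxu
  refine ⟨hu1, ?_⟩
  refine eq_inv_of_mul_eq_one_right ?_
  rw [← map_mul, hu2, map_one]

theorem exists_of_mem (h : x ∈ V) : ∃ y, SpecializesTo V x y := ⟨_, h, rfl⟩

theorem inv_of_notMem (h : x ∉ V) : SpecializesTo V x⁻¹ 0 := by
  have hx : x⁻¹ ∈ V := (V.mem_or_inv_mem x).resolve_left h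
  refine ⟨hx, (IsLocalRing.residue_eq_zero_iff _).2 fun hu => h ?_⟩
  obtain ⟨⟨u, hu1⟩, hu2⟩ := hu.exists_right_inv
  have hxu : x⁻¹ * u = 1 := congrArg Subtype.val hu2
  obtain rfl : u = x := by
    have hx0 : x ≠ 0 := by rintro rfl; exact h V.zero_mem
    field_simp at hxu
    exact hxu
  exact hu1

theorem notMem_of_inv (h : SpecializesTo V x⁻¹ 0) (hx : x ≠ 0) : x ∉ V := fun hm => by
  obtain ⟨y, hy⟩ := exists_of_mem hm
  have := (h.mul hy).congr (inv_mul_cancel₀ hx) (zero_mul y)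
  exact one_ne_zero (one.unique this)

/-- `V` is closed under roots. -/
theorem exists_of_pow {n : ℕ} (hn : n ≠ 0) (h : SpecializesTo V (x ^ n) y) :
    ∃ y', SpecializesTo V x y' ∧ y' ^ n = y := by
  have hx : x ∈ V := by
    by_contra hx
    have h0 : x ≠ 0 := by rintro rfl; exact hx V.zero_mem
    have := ((inv_of_notMem hx).pow n).congr (inv_pow x n) (zero_pow hn)
    exact notMem_of_inv this (pow_ne_zero n h0) h.1
  obtain ⟨y', hy'⟩ := exists_of_mem hx
  exact ⟨y', hy', (hy'.pow n).unique h⟩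

theorem zero_of_pow {n : ℕ} (hn : n ≠ 0) (h : SpecializesTo V (x ^ n) 0) :
    SpecializesTo V x 0 := by
  obtain ⟨y', h', hy'⟩ := exists_of_pow hn h
  rwa [eq_zero_of_pow_eq_zero hy'] at h'

end SpecializesTo

variable (V) in
/-- Componentwise specialization of dual numbers. -/
def DualSpecializesTo (x : DualNumber K) (y : DualNumber (IsLocalRing.ResidueField V)) : Prop :=
  SpecializesTo V x.fst y.fst ∧ SpecializesTo V x.snd y.snd

variable {X X' : DualNumber K} {Y Y' : DualNumber (IsLocalRing.ResidueField V)}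

namespace DualSpecializesTo

theorem add (h : DualSpecializesTo V X Y) (h' : DualSpecializesTo V X' Y') :
    DualSpecializesTo V (X + X') (Y + Y') :=
  ⟨by simpa using h.1.add h'.1, by simpa using h.2.add h'.2⟩

theorem mul (h : DualSpecializesTo V X Y) (h' : DualSpecializesTo V X' Y') :
    DualSpecializesTo V (X * X') (Y * Y') :=
  ⟨by simpa using h.1.mul h'.1, by simpa using (h.1.mul h'.2).add (h.2.mul h'.1)⟩

theorem neg (h : DualSpecializesTo V X Y) : DualSpecializesTo V (-X) (-Y) :=
  ⟨by simpa using h.1.neg, by simpa using h.2.neg⟩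

theorem sub (h : DualSpecializesTo V X Y) (h' : DualSpecializesTo V X' Y') :
    DualSpecializesTo V (X - X') (Y - Y') :=
  ⟨by simpa using h.1.sub h'.1, by simpa using h.2.sub h'.2⟩

theorem inl {x : K} {y : IsLocalRing.ResidueField V} (h : SpecializesTo V x y) :
    DualSpecializesTo V (TrivSqZeroExt.inl x) (TrivSqZeroExt.inl y) :=
  ⟨by simpa using h, by simpa using SpecializesTo.zero⟩

theorem zero : DualSpecializesTo V 0 0 := ⟨SpecializesTo.zero, SpecializesTo.zero⟩

theorem one : DualSpecializesTo V 1 1 :=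
  ⟨by simpa using SpecializesTo.one, by simpa using SpecializesTo.zero⟩

theorem natCast (n : ℕ) : DualSpecializesTo V n n := by
  induction n with
  | zero => simpa using zero
  | succ n ih => simpa using ih.add one

theorem ofNat (n : ℕ) [n.AtLeastTwo] : DualSpecializesTo V (OfNat.ofNat n) (OfNat.ofNat n) :=
  natCast n

theorem pow (h : DualSpecializesTo V X Y) (n : ℕ) : DualSpecializesTo V (X ^ n) (Y ^ n) := by
  induction n with
  | zero => simpa using one
  | succ n ih => simpa [pow_succ] using ih.mul h

theorem unique (h : DualSpecializesTo V X Y) (h' : DualSpecializesTo V X Y') : Y = Y' :=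
  TrivSqZeroExt.ext (h.1.unique h'.1) (h.2.unique h'.2)

theorem congr (h : DualSpecializesTo V X Y) (hx : X = X') (hy : Y = Y') :
    DualSpecializesTo V X' Y' := hx ▸ hy ▸ h

theorem inv (h : DualSpecializesTo V X Y) (hy : Y.fst ≠ 0) : DualSpecializesTo V X⁻¹ Y⁻¹ := by
  have h1 := h.1.inv hy
  refine ⟨by simpa using h1, ?_⟩
  simpa using ((h1.mul h.2).mul h1).neg

/-- Dual numbers in the valuation ring have a square root there if the residue is a unit. -/
theorem exists_of_sq [NeZero (2 : IsLocalRing.ResidueField V)]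
    (h : DualSpecializesTo V (X ^ 2) Y) (hy : Y.fst ≠ 0) :
    ∃ Y', DualSpecializesTo V X Y' ∧ Y' ^ 2 = Y := by
  have h1 : SpecializesTo V (X.fst ^ 2) Y.fst := by simpa using h.1
  obtain ⟨y, hy1, hy2⟩ := h1.exists_of_pow two_ne_zero
  have hy0 : y ≠ 0 := by rintro rfl; apply hy; rw [← hy2]; simp
  have h20 : (2 : IsLocalRing.ResidueField V) ≠ 0 := NeZero.ne _
  have h2y := (SpecializesTo.ofNat (V := V) 2).mul hy1
  have hX0 := h2y.ne_zero (mul_ne_zero h20 hy0)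
  have h2 := (h2y.inv (mul_ne_zero h20 hy0)).mul h.2
  -- The derivative of a square root is recovered from that of the square, and it is finite because
  -- twice the root is a unit.
  have h3 : (2 * X.fst)⁻¹ * (X ^ 2).snd = X.snd := by
    have : (X ^ 2).snd = 2 * X.fst * X.snd := by
      rw [pow_two]; simp; ring
    rw [this, inv_mul_cancel_left₀ hX0]
  rw [h3] at h2
  have hX : DualSpecializesTo V X (TrivSqZeroExt.inl y + TrivSqZeroExt.inr _) :=
    ⟨by simpa using hy1, by simpa using h2⟩
  exact ⟨_, hX, (hX.pow 2).unique h⟩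

end DualSpecializesTo

end Specialization

/-! ### Jets of a motion with a rigid pair and their symmetries -/

section RigidPair

/-- First order jets, with values in a field `K`, of a motion of three equal masses two of which
keep their distance. In the frame in which these two rest at `1` and `-1`, the third body is at `z`
and has the inertial velocity `p`, while `zb` and `pb` are the conjugates, `w` is the angular
velocity, `ρ` the quotient of the distances `r`, `s` of the third body from `-1`, `1`, `j` the
imaginary unit, and `L`, `E` are the values of the angular momentum and energy integrals. -/
structure RigidPairJet (K : Type*) [Field K] where
  (j κ L E r s : K)
  (z zb p pb w ρ : DualNumber K)
  j_sq : j ^ 2 = -1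
  r_ne : r ≠ 0
  s_ne : s ≠ 0
  r_sq : r ^ 2 = (z.fst + 1) * (zb.fst + 1)
  s_sq : s ^ 2 = (z.fst - 1) * (zb.fst - 1)
  ρ_sq : ρ ^ 2 * ((z - 1) * (zb - 1)) = (z + 1) * (zb + 1)
  z_snd : z.snd = p.fst - j * w.fst * z.fst
  zb_snd : zb.snd = pb.fst + j * w.fst * zb.fst
  p_snd : p.snd = -(j * w.fst * p.fst)
    - 6 * κ * (r⁻¹ ^ 3 * (z.fst + 1) + s⁻¹ ^ 3 * (z.fst - 1))
  pb_snd : pb.snd = j * w.fst * pb.fst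
    - 6 * κ * (r⁻¹ ^ 3 * (zb.fst + 1) + s⁻¹ ^ 3 * (zb.fst - 1))
  w_snd : w.snd = j * κ * ((r⁻¹ ^ 3 - s⁻¹ ^ 3) * (z.fst - zb.fst))
  angular_momentum : zb.fst * p.fst - z.fst * pb.fst + 6 * j * w.fst = L
  energy : p.fst * pb.fst - 12 * κ * (r⁻¹ + s⁻¹) + 3 * w.fst ^ 2 = E
  rigidity : w.fst ^ 2 = κ * (1 + (r⁻¹ ^ 3 * (z.fst + 1) + r⁻¹ ^ 3 * (zb.fst + 1))
    - (s⁻¹ ^ 3 * (z.fst - 1) + s⁻¹ ^ 3 * (zb.fst - 1)))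
  rigidity_deriv : 6 * inl j * w * (1 - ρ ^ 3) * (z - zb) * ((z + 1) * (zb + 1)) =
    -3 * (p * (zb + 1) + pb * (z + 1) - inl j * w * (z - zb)) * ((z + 1) + (zb + 1))
    + 3 * ρ ^ 5 * (p * (zb - 1) + pb * (z - 1) + inl j * w * (z - zb)) * ((z - 1) + (zb - 1))
    + 2 * (1 - ρ ^ 3) * ((z + 1) * (zb + 1)) * (p + pb)

namespace RigidPairJet

variable {K : Type*} [Field K]

/-- Complex conjugation. -/
def conj (D : RigidPairJet K) : RigidPairJet K where
  j := -D.j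
  κ := D.κ
  L := -D.L
  E := D.E
  r := D.r
  s := D.s
  z := D.zb
  zb := D.z
  p := D.pb
  pb := D.p
  w := D.w
  ρ := D.ρ
  j_sq := by rw [neg_sq, D.j_sq]
  r_ne := D.r_ne
  s_ne := D.s_ne
  r_sq := by rw [D.r_sq, mul_comm]
  s_sq := by rw [D.s_sq, mul_comm]
  ρ_sq := by linear_combination D.ρ_sq
  z_snd := by rw [D.zb_snd]; ring
  zb_snd := by rw [D.z_snd]; ring
  p_snd := by rw [D.pb_snd]; ring
  pb_snd := by rw [D.p_snd]; ring
  w_snd := by rw [D.w_snd]; ring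
  angular_momentum := by linear_combination -D.angular_momentum
  energy := by linear_combination D.energy
  rigidity := by linear_combination D.rigidity
  rigidity_deriv := by rw [inl_neg]; linear_combination D.rigidity_deriv

theorem ρ_fst_ne_zero (D : RigidPairJet K) : D.ρ.fst ≠ 0 := by
  intro h
  have := congrArg fst D.ρ_sq
  simp [h] at this
  have h2 := D.r_sq
  rcases this with h | h <;> · rw [h] at h2; simp at h2; exact D.r_ne h2

/-- The half turn, which interchanges the two bodies of the rigid pair. -/
def swap (D : RigidPairJet K) : RigidPairJet K where
  j := D.j
  κ := D.κ
  L := D.L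
  E := D.E
  r := D.s
  s := D.r
  z := -D.z
  zb := -D.zb
  p := -D.p
  pb := -D.pb
  w := D.w
  ρ := D.ρ⁻¹
  j_sq := D.j_sq
  r_ne := D.s_ne
  s_ne := D.r_ne
  r_sq := by simp only [fst_neg]; rw [D.s_sq]; ring
  s_sq := by simp only [fst_neg]; rw [D.r_sq]; ring
  ρ_sq := by
    have h := TrivSqZeroExt.mul_inv_cancel D.ρ_fst_ne_zero
    linear_combination -D.ρ⁻¹ ^ 2 * D.ρ_sq + (D.z - 1) * (D.zb - 1) * (D.ρ * D.ρ⁻¹ + 1) * h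
  z_snd := by simp only [fst_neg, snd_neg]; rw [D.z_snd]; ring
  zb_snd := by simp only [fst_neg, snd_neg]; rw [D.zb_snd]; ring
  p_snd := by simp only [fst_neg, snd_neg]; rw [D.p_snd]; ring
  pb_snd := by simp only [fst_neg, snd_neg]; rw [D.pb_snd]; ring
  w_snd := by simp only [fst_neg]; rw [D.w_snd]; ring
  angular_momentum := by simp only [fst_neg]; linear_combination D.angular_momentum
  energy := by simp only [fst_neg]; linear_combination D.energy
  rigidity := by simp only [fst_neg]; linear_combination D.rigidity
  rigidity_deriv := by
    have h := TrivSqZeroExt.mul_inv_cancel D.ρ_fst_ne_zero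
    have h2 := D.ρ_sq
    have h3 := D.rigidity_deriv
    -- With `(z + 1) * (zb + 1)` replaced by `ρ ^ 2 * ((z - 1) * (zb - 1))`, multiplication by `ρ⁻¹
    -- ^ 5` gives the relation for the exchanged bodies.
    rw [← h2] at h3
    generalize D.ρ⁻¹ = u at *
    generalize D.ρ = v at *
    generalize (inl D.j : DualNumber K) = J at *
    have h5 : u ^ 5 * v ^ 5 = 1 := by rw [← mul_pow, mul_comm, h, one_pow]
    have h25 : u ^ 5 * v ^ 2 = u ^ 3 := by
      linear_combination u ^ 3 * (u * v + 1) * h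
    have h55 : u ^ 5 * (1 - v ^ 3) * v ^ 2 = u ^ 3 - 1 := by
      linear_combination h25 - h5
    linear_combination u ^ 5 * h3
      - (6 * J * D.w * (D.z - D.zb) * ((D.z - 1) * (D.zb - 1))
        - 2 * ((D.z - 1) * (D.zb - 1)) * (D.p + D.pb)) * h55
      + 3 * (D.p * (D.zb - 1) + D.pb * (D.z - 1) + J * D.w * (D.z - D.zb))
        * ((D.z - 1) + (D.zb - 1)) * h5

variable {V : ValuationSubring K}

/-- The squares of these quantities are monomials in `a⁻¹` and `b⁻¹`, for instance `(r⁻¹ ^ 3 * a) ^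
2 = a⁻¹ * b⁻¹ ^ 3`. Each contains a positive power of `a⁻¹`, and `V` is closed under roots. -/
theorem forces_specializeTo_zero {r a b : K} (hr : r ≠ 0) (h : r ^ 2 = a * b)
    (ha : SpecializesTo V a⁻¹ 0) (hb : b⁻¹ ∈ V) :
    SpecializesTo V r⁻¹ 0 ∧ SpecializesTo V (r⁻¹ ^ 3) 0 ∧
      SpecializesTo V (r⁻¹ ^ 3 * a) 0 ∧ SpecializesTo V (r⁻¹ ^ 3 * b) 0 := by
  have hab : a * b ≠ 0 := h ▸ pow_ne_zero 2 hr
  obtain ⟨ha0, hb0⟩ := mul_ne_zero_iff.1 hab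
  obtain ⟨y, hy⟩ := SpecializesTo.exists_of_mem hb
  have h1 : SpecializesTo V r⁻¹ 0 := by
    refine SpecializesTo.zero_of_pow two_ne_zero ((ha.mul hy).congr ?_ (zero_mul _))
    rw [inv_pow, h, mul_inv]
  refine ⟨h1, (h1.pow 3).congr rfl (by simp), ?_, ?_⟩
  · refine SpecializesTo.zero_of_pow two_ne_zero ((ha.mul (hy.pow 3)).congr ?_ (zero_mul _))
    have : (r⁻¹ ^ 3 * a) ^ 2 = ((r ^ 2) ^ 3)⁻¹ * a ^ 2 := by field_simp
    rw [this, h]; field_simp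
  · refine SpecializesTo.zero_of_pow two_ne_zero
      (((ha.pow 3).mul hy).congr ?_ (by simp))
    have : (r⁻¹ ^ 3 * b) ^ 2 = ((r ^ 2) ^ 3)⁻¹ * b ^ 2 := by field_simp
    rw [this, h]; field_simp

/-- Eliminating `p` from the two integrals gives the quadratic equation `pb ^ 2 = z⁻¹ * (zb * e - l
* pb)`, whose right side is small compared with `1` or with `pb ^ 2`. -/
theorem momentum_specializesTo_zero {z zb p pb l e : K} (hz : z ∉ V) (hzb : zb ∈ V) (hl : l ∈ V)
    (he : e ∈ V) (h1 : zb * p - z * pb = l) (h2 : p * pb = e) : SpecializesTo V pb 0 := by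
  have hz0 : z ≠ 0 := by rintro rfl; exact hz V.zero_mem
  have hι := SpecializesTo.inv_of_notMem hz
  obtain ⟨_, hzb⟩ := SpecializesTo.exists_of_mem hzb
  obtain ⟨_, hl⟩ := SpecializesTo.exists_of_mem hl
  obtain ⟨_, he⟩ := SpecializesTo.exists_of_mem he
  have key : pb ^ 2 = z⁻¹ * (zb * e - l * pb) := by
    field_simp
    linear_combination zb * h2 - pb * h1
  by_cases hpb : pb ∈ V
  · obtain ⟨_, hpb⟩ := SpecializesTo.exists_of_mem hpb
    exact SpecializesTo.zero_of_pow two_ne_zero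
      ((hι.mul ((hzb.mul he).sub (hl.mul hpb))).congr key.symm (zero_mul _))
  · have hpb0 : pb ≠ 0 := by rintro rfl; exact hpb V.zero_mem
    have hi := SpecializesTo.inv_of_notMem hpb
    refine absurd ((hι.mul (((hzb.mul he).mul (hi.pow 2)).sub (hl.mul hi))).congr
      (x' := 1) ?_ (zero_mul _)) fun h => one_ne_zero (SpecializesTo.one.unique h)
    have : z⁻¹ * (zb * e * pb⁻¹ ^ 2 - l * pb⁻¹) = pb⁻¹ ^ 2 * (z⁻¹ * (zb * e - l * pb)) := by
      field_simp
    rw [this, ← key]; field_simp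

theorem j_specializesTo (D : RigidPairJet K) : ∃ j₀, SpecializesTo V D.j j₀ ∧ j₀ ^ 2 = -1 :=
  SpecializesTo.exists_of_pow two_ne_zero
    (SpecializesTo.one.neg.congr D.j_sq.symm rfl)

/-- The differentiated rigidity condition in variables relative to `z`. -/
theorem rigidity_deriv_div (D : RigidPairJet K) (ι : DualNumber K) :
    6 * inl D.j * D.w * (1 - D.ρ ^ 3) * ((D.z - D.zb) * ι) * (((D.z + 1) * ι) * (D.zb + 1)) =
    -3 * ((D.p * ι) * (D.zb + 1) + D.pb * ((D.z + 1) * ι) - inl D.j * D.w * ((D.z - D.zb) * ι)) *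
      (((D.z + 1) * ι) + (D.zb + 1) * ι)
    + 3 * D.ρ ^ 5 * ((D.p * ι) * (D.zb - 1) + D.pb * ((D.z - 1) * ι)
      + inl D.j * D.w * ((D.z - D.zb) * ι)) * (((D.z - 1) * ι) + (D.zb - 1) * ι)
    + 2 * (1 - D.ρ ^ 3) * (((D.z + 1) * ι) * (D.zb + 1)) * ((D.p * ι) + D.pb * ι) := by
  linear_combination ι ^ 2 * D.rigidity_deriv

theorem inv_snd_eq (D : RigidPairJet K) (hz : D.z.fst ≠ 0) :
    (D.z⁻¹).snd = -(D.z⁻¹.fst * ((D.p * D.z⁻¹).fst - D.j * D.w.fst)) := by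
  simp [D.z_snd]; field_simp

/-- The logarithmic velocity `p / z` satisfies a Riccati equation: the rotation terms cancel, and
the force enters divided by `z`. -/
theorem p_div_snd_eq (D : RigidPairJet K) (hz : D.z.fst ≠ 0) :
    (D.p * D.z⁻¹).snd = - 6 * D.κ * (D.r⁻¹ ^ 3 * (D.z.fst + 1) + D.s⁻¹ ^ 3 * (D.z.fst - 1)) *
      D.z.fst⁻¹ - (D.p.fst * D.z.fst⁻¹) ^ 2 := by
  simp [D.z_snd, D.p_snd]; field_simp; ring

end RigidPairJet

end RigidPair

/-! ### Leading terms of the relations where `z` is infinite -/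

section RigidPair

namespace RigidPairJet

variable {K : Type*} [Field K] {V : ValuationSubring K}

/-- The relation is homogeneous of degree one in `p`, `pb`, `w`, so velocities may be rescaled by
any `t`. This keeps residues available when a velocity is infinite. -/
theorem rigidity_deriv_fst (D : RigidPairJet K) (ι t : K) :
    6 * D.j * (D.w.fst * t) * (1 - D.ρ.fst ^ 3) * ((D.z.fst - D.zb.fst) * ι)
      * (((D.z.fst + 1) * ι) * (D.zb.fst + 1)) =
    -3 * ((D.p.fst * ι * t) * (D.zb.fst + 1) + D.pb.fst * t * ((D.z.fst + 1) * ι)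
      - D.j * (D.w.fst * t) * ((D.z.fst - D.zb.fst) * ι)) *
      (((D.z.fst + 1) * ι) + (D.zb.fst + 1) * ι)
    + 3 * D.ρ.fst ^ 5 * ((D.p.fst * ι * t) * (D.zb.fst - 1) + D.pb.fst * t * ((D.z.fst - 1) * ι)
      + D.j * (D.w.fst * t) * ((D.z.fst - D.zb.fst) * ι))
      * (((D.z.fst - 1) * ι) + (D.zb.fst - 1) * ι)
    + 2 * (1 - D.ρ.fst ^ 3) * (((D.z.fst + 1) * ι) * (D.zb.fst + 1))
      * ((D.p.fst * ι * t) + D.pb.fst * t * ι) := by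
  have h := congrArg (fstHom K K K) D.rigidity_deriv
  simp only [map_mul, map_add, map_sub, map_neg, map_pow, map_one, map_ofNat, fstHom_apply,
    fst_inl] at h
  linear_combination ι ^ 2 * t * h

theorem ratio_specializesTo {ι x : K} (hι : SpecializesTo V ι 0) (hx : x * ι = 1) :
    SpecializesTo V ((x + 1) * ι) 1 ∧ SpecializesTo V ((x - 1) * ι) 1 :=
  ⟨(SpecializesTo.one.add hι).congr (by linear_combination -hx) (add_zero 1),
    (SpecializesTo.one.sub hι).congr (by linear_combination -hx) (sub_zero 1)⟩

/-- Leading terms of the rigidity condition where `z` is infinite and `zb` is finite. -/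
theorem rigidity_deriv_fst_residue (D : RigidPairJet K) {t : K}
    {j₀ y W M R : IsLocalRing.ResidueField V}
    (hj : SpecializesTo V D.j j₀) (hz : D.z.fst ∉ V) (hzb : SpecializesTo V D.zb.fst y)
    (hw : SpecializesTo V (D.w.fst * t) W) (hp : SpecializesTo V (D.p.fst * D.z.fst⁻¹ * t) M)
    (hpb : SpecializesTo V (D.pb.fst * t) 0) (hρ : SpecializesTo V D.ρ.fst R) :
    6 * j₀ * W * (1 - R ^ 3) * (y + 1) = -3 * (M * (y + 1) - j₀ * W)
      + 3 * R ^ 5 * (M * (y - 1) + j₀ * W) + 2 * (1 - R ^ 3) * (y + 1) * M := by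
  have hz0 : D.z.fst ≠ 0 := fun h => hz (h ▸ V.zero_mem)
  have hι := SpecializesTo.inv_of_notMem hz
  obtain ⟨hα, hβ⟩ := ratio_specializesTo hι (mul_inv_cancel₀ hz0)
  have hd : SpecializesTo V ((D.z.fst - D.zb.fst) * D.z.fst⁻¹) 1 :=
    (SpecializesTo.one.sub (hzb.mul hι)).congr (by field_simp) (by simp)
  have ha := hzb.add SpecializesTo.one
  have hb := hzb.sub SpecializesTo.one
  have h3 := SpecializesTo.one.sub (hρ.pow 3)
  have n := fun (n : ℕ) [n.AtLeastTwo] => SpecializesTo.ofNat (V := V) n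
  have lhs := (((((n 6).mul hj).mul hw).mul h3).mul hd).mul (hα.mul ha)
  have rhs := (((n 3).neg.mul (((hp.mul ha).add (hpb.mul hα)).sub ((hj.mul hw).mul hd))).mul
      (hα.add (ha.mul hι))).add
    ((((n 3).mul (hρ.pow 5)).mul (((hp.mul hb).add (hpb.mul hβ)).add ((hj.mul hw).mul hd))).mul
      (hβ.add (hb.mul hι))) |>.add
    ((((n 2).mul h3).mul (hα.mul ha)).mul (hp.add (hpb.mul hι)))
  have := lhs.unique (rhs.congr (D.rigidity_deriv_fst _ t).symm rfl)
  linear_combination this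

/-- Leading terms of the jet of the rigidity condition where `z` is infinite and `zb` is finite. -/
theorem rigidity_deriv_residue (D : RigidPairJet K) {j₀ : IsLocalRing.ResidueField V}
    {Y W M R₃ R₅ : DualNumber (IsLocalRing.ResidueField V)}
    (hj : SpecializesTo V D.j j₀) (hz0 : D.z.fst ≠ 0) (hι : DualSpecializesTo V D.z⁻¹ 0)
    (hzb : DualSpecializesTo V D.zb Y) (hw : DualSpecializesTo V D.w W)
    (hp : DualSpecializesTo V (D.p * D.z⁻¹) M) (hpb : DualSpecializesTo V D.pb 0)
    (hρ3 : DualSpecializesTo V (D.ρ ^ 3) R₃) (hρ5 : DualSpecializesTo V (D.ρ ^ 5) R₅) :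
    6 * inl j₀ * W * (1 - R₃) * (Y + 1) = -3 * (M * (Y + 1) - inl j₀ * W)
      + 3 * R₅ * (M * (Y - 1) + inl j₀ * W) + 2 * (1 - R₃) * (Y + 1) * M := by
  have hz := TrivSqZeroExt.mul_inv_cancel hz0
  have hα : DualSpecializesTo V ((D.z + 1) * D.z⁻¹) 1 :=
    (DualSpecializesTo.one.add hι).congr (by linear_combination -hz) (add_zero 1)
  have hβ : DualSpecializesTo V ((D.z - 1) * D.z⁻¹) 1 :=
    (DualSpecializesTo.one.sub hι).congr (by linear_combination -hz) (sub_zero 1)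
  have hd : DualSpecializesTo V ((D.z - D.zb) * D.z⁻¹) 1 :=
    (DualSpecializesTo.one.sub (hzb.mul hι)).congr (by linear_combination -hz) (by simp)
  have ha := hzb.add DualSpecializesTo.one
  have hb := hzb.sub DualSpecializesTo.one
  have h3 := DualSpecializesTo.one.sub hρ3
  have hj := DualSpecializesTo.inl hj
  have n := fun (n : ℕ) [n.AtLeastTwo] => DualSpecializesTo.ofNat (V := V) n
  have lhs := (((((n 6).mul hj).mul hw).mul h3).mul hd).mul (hα.mul ha)
  have rhs := (((n 3).neg.mul (((hp.mul ha).add (hpb.mul hα)).sub ((hj.mul hw).mul hd))).mul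
      (hα.add (ha.mul hι))).add
    ((((n 3).mul hρ5).mul (((hp.mul hb).add (hpb.mul hβ)).add ((hj.mul hw).mul hd))).mul
      (hβ.add (hb.mul hι))) |>.add
    ((((n 2).mul h3).mul (hα.mul ha)).mul (hp.add (hpb.mul hι)))
  have := lhs.unique (rhs.congr (D.rigidity_deriv_div _).symm rfl)
  linear_combination this

theorem inv_dualSpecializesTo_zero (D : RigidPairJet K) (hz : D.z.fst ∉ V) (hj : D.j ∈ V)
    (hw : D.w.fst ∈ V) (hp : D.p.fst * D.z.fst⁻¹ ∈ V) : DualSpecializesTo V D.z⁻¹ 0 := by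
  have hz0 : D.z.fst ≠ 0 := fun h => hz (h ▸ V.zero_mem)
  have hι := SpecializesTo.inv_of_notMem hz
  obtain ⟨_, hj⟩ := SpecializesTo.exists_of_mem hj
  obtain ⟨_, hw⟩ := SpecializesTo.exists_of_mem hw
  obtain ⟨_, hp⟩ := SpecializesTo.exists_of_mem hp
  refine ⟨by simpa using hι, (hι.mul (hp.sub (hj.mul hw))).neg.congr ?_ (by simp)⟩
  rw [D.inv_snd_eq hz0]; simp

/-- Where `z` is infinite and the third body is away from the isotropic lines through the rigid
pair, the forces vanish. -/
theorem far_forces (D : RigidPairJet K) (hz : D.z.fst ∉ V) (ha : (D.zb.fst + 1)⁻¹ ∈ V)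
    (hb : (D.zb.fst - 1)⁻¹ ∈ V) :
    (SpecializesTo V D.r⁻¹ 0 ∧ SpecializesTo V (D.r⁻¹ ^ 3) 0 ∧
      SpecializesTo V (D.r⁻¹ ^ 3 * (D.z.fst + 1)) 0 ∧
      SpecializesTo V (D.r⁻¹ ^ 3 * (D.zb.fst + 1)) 0) ∧
    (SpecializesTo V D.s⁻¹ 0 ∧ SpecializesTo V (D.s⁻¹ ^ 3) 0 ∧
      SpecializesTo V (D.s⁻¹ ^ 3 * (D.z.fst - 1)) 0 ∧
      SpecializesTo V (D.s⁻¹ ^ 3 * (D.zb.fst - 1)) 0) := by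
  refine ⟨forces_specializeTo_zero D.r_ne D.r_sq (SpecializesTo.inv_of_notMem fun h => hz ?_) ha,
    forces_specializeTo_zero D.s_ne D.s_sq (SpecializesTo.inv_of_notMem fun h => hz ?_) hb⟩
  · simpa using sub_mem h V.one_mem
  · simpa using add_mem h V.one_mem

/-- With the third body's forces gone, the constraint reduces to the Kepler relation for a circular
two-body orbit, with vanishing angular acceleration. -/
theorem far_angular_velocity (D : RigidPairJet K) {κ₀ : IsLocalRing.ResidueField V}
    (hκ : SpecializesTo V D.κ κ₀) (hz : D.z.fst ∉ V) (ha : (D.zb.fst + 1)⁻¹ ∈ V)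
    (hb : (D.zb.fst - 1)⁻¹ ∈ V) :
    ∃ w₀, DualSpecializesTo V D.w (inl w₀) ∧ w₀ ^ 2 = κ₀ := by
  obtain ⟨⟨-, -, h1, h2⟩, -, -, h3, h4⟩ := D.far_forces hz ha hb
  obtain ⟨w₀, hw, hw2⟩ := SpecializesTo.exists_of_pow two_ne_zero
    ((hκ.mul ((SpecializesTo.one.add (h1.add h2)).sub (h3.add h4))).congr D.rigidity.symm
      (y' := κ₀) (by simp))
  obtain ⟨j₀, hj, -⟩ := D.j_specializesTo (V := V)
  refine ⟨w₀, ⟨by simpa using hw, ?_⟩, hw2⟩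
  refine ((hj.mul hκ).mul ((h1.sub h2).sub (h3.sub h4))).congr ?_ (by simp)
  rw [D.w_snd]; ring

theorem far_integrals (D : RigidPairJet K) (hκ : D.κ ∈ V) (hL : D.L ∈ V) (hE : D.E ∈ V)
    (hz : D.z.fst ∉ V) (ha : (D.zb.fst + 1)⁻¹ ∈ V) (hb : (D.zb.fst - 1)⁻¹ ∈ V) :
    D.zb.fst * D.p.fst - D.z.fst * D.pb.fst ∈ V ∧ D.p.fst * D.pb.fst ∈ V := by
  obtain ⟨_, hκ⟩ := SpecializesTo.exists_of_mem hκ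
  obtain ⟨_, hL⟩ := SpecializesTo.exists_of_mem hL
  obtain ⟨_, hE⟩ := SpecializesTo.exists_of_mem hE
  obtain ⟨⟨h1, -⟩, h2, -⟩ := D.far_forces hz ha hb
  obtain ⟨w₀, ⟨hw, -⟩, -⟩ := D.far_angular_velocity hκ hz ha hb
  obtain ⟨j₀, hj, -⟩ := D.j_specializesTo (V := V)
  have n := fun (n : ℕ) [n.AtLeastTwo] => SpecializesTo.ofNat (V := V) n
  refine ⟨((hL.sub (((n 6).mul hj).mul hw)).congr ?_ rfl).1,
    (((hE.add (((n 12).mul hκ).mul (h1.add h2))).sub ((n 3).mul (hw.pow 2))).congr ?_ rfl).1⟩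
  · linear_combination -D.angular_momentum
  · linear_combination -D.energy

end RigidPairJet

end RigidPair

/-! ### Places with `z` infinite and `zb` finite, away from the isotropic lines -/

section RigidPair

namespace RigidPairJet

variable {K : Type*} [Field K] {V : ValuationSubring K}

theorem ratio_sq_fst (D : RigidPairJet K) :
    D.ρ.fst ^ 2 * ((D.z.fst - 1) * (D.zb.fst - 1)) = (D.z.fst + 1) * (D.zb.fst + 1) := by
  have h := congrArg (fstHom K K K) D.ρ_sq
  simpa only [map_mul, map_add, map_sub, map_pow, map_one, fstHom_apply] using h

theorem ratio_sq_specializesTo (D : RigidPairJet K) (hz : D.z.fst ∉ V)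
    {y : IsLocalRing.ResidueField V} (hzb : SpecializesTo V D.zb.fst y) (hb : y - 1 ≠ 0) :
    SpecializesTo V (D.ρ.fst ^ 2) ((y + 1) * (y - 1)⁻¹) := by
  have hz0 : D.z.fst ≠ 0 := fun h => hz (h ▸ V.zero_mem)
  obtain ⟨hα, hβ⟩ := ratio_specializesTo (SpecializesTo.inv_of_notMem hz) (mul_inv_cancel₀ hz0)
  have hb' := hzb.sub SpecializesTo.one
  have hβ0 := hβ.ne_zero one_ne_zero
  have hb0 := hb'.ne_zero hb
  refine ((hα.mul (hzb.add SpecializesTo.one)).mul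
    ((hβ.mul hb').inv (by simpa using hb))).congr ?_ (by simp)
  rw [mul_inv_eq_iff_eq_mul₀ (mul_ne_zero hβ0 hb0)]
  linear_combination -D.z.fst⁻¹ * D.ratio_sq_fst

theorem ratio_sq_dualSpecializesTo (D : RigidPairJet K) (hz0 : D.z.fst ≠ 0)
    (hι : DualSpecializesTo V D.z⁻¹ 0) {Y : DualNumber (IsLocalRing.ResidueField V)}
    (hzb : DualSpecializesTo V D.zb Y) (hb : Y.fst - 1 ≠ 0) :
    DualSpecializesTo V (D.ρ ^ 2) ((Y + 1) * (Y - 1)⁻¹) := by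
  have hz := TrivSqZeroExt.mul_inv_cancel hz0
  have hα : DualSpecializesTo V ((D.z + 1) * D.z⁻¹) 1 :=
    (DualSpecializesTo.one.add hι).congr (by linear_combination -hz) (add_zero 1)
  have hβ : DualSpecializesTo V ((D.z - 1) * D.z⁻¹) 1 :=
    (DualSpecializesTo.one.sub hι).congr (by linear_combination -hz) (sub_zero 1)
  have hβb := hβ.mul (hzb.sub DualSpecializesTo.one)
  have h0 : (1 * (Y - 1)).fst ≠ 0 := by simpa using hb
  have h1 := TrivSqZeroExt.mul_inv_cancel (hβb.1.ne_zero h0)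
  refine ((hα.mul (hzb.add DualSpecializesTo.one)).mul (hβb.inv h0)).congr ?_ (by simp)
  linear_combination D.ρ ^ 2 * h1 -
    D.z⁻¹ * ((D.z - 1) * D.z⁻¹ * (D.zb - 1))⁻¹ * D.ρ_sq

/-- The septic has no multiple root: the cofactors are those of a Bézout identity between it and its
derivative. -/
theorem separable_aux {k : Type*} [Field k] [CharZero k] {x : k}
    (h : x ^ 7 + 3 * x ^ 5 - 3 * x ^ 2 - 1 = 0) (h' : 7 * x ^ 6 + 15 * x ^ 4 - 6 * x = 0) :
    False := by
  have : (42496 : k) = 0 := by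
    linear_combination (-42496 - 28350 * x + 30930 * x ^ 2 + 49410 * x ^ 3 + 17325 * x ^ 4
      + 30261 * x ^ 5) * h + (4725 + 16093 * x + 5940 * x ^ 2 - 6540 * x ^ 3 - 10764 * x ^ 4
      - 2475 * x ^ 5 - 4323 * x ^ 6) * h'
  norm_num at this

/-- No place with `z` infinite and `zb` finite, away from the isotropic lines. -/
theorem false_of_conj_finite [CharZero (IsLocalRing.ResidueField V)] (D : RigidPairJet K)
    {κ₀ y : IsLocalRing.ResidueField V} (hκ : SpecializesTo V D.κ κ₀) (hκ₀ : κ₀ ≠ 0)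
    (hL : D.L ∈ V) (hE : D.E ∈ V) (hz : D.z.fst ∉ V) (hzb : SpecializesTo V D.zb.fst y)
    (ha : y + 1 ≠ 0) (hb : y - 1 ≠ 0) : False := by
  have hz0 : D.z.fst ≠ 0 := fun h => hz (h ▸ V.zero_mem)
  have hι := SpecializesTo.inv_of_notMem hz
  have ha' := ((hzb.add SpecializesTo.one).inv ha).1
  have hb' := ((hzb.sub SpecializesTo.one).inv hb).1
  obtain ⟨⟨-, hA, hAa, hAab⟩, -, hB, hBb, hBbb⟩ := D.far_forces hz ha' hb'
  obtain ⟨w₀, hw, hw₀⟩ := D.far_angular_velocity hκ hz ha' hb'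
  have hw' : SpecializesTo V D.w.fst w₀ := by simpa using hw.1
  have hw0 : w₀ ≠ 0 := by rintro rfl; apply hκ₀; rw [← hw₀]; simp
  obtain ⟨hl, he⟩ := D.far_integrals hκ.1 hL hE hz ha' hb'
  obtain ⟨j₀, hj, hj₀⟩ := D.j_specializesTo (V := V)
  have hj0 : j₀ ≠ 0 := by rintro rfl; norm_num at hj₀
  have n := fun (n : ℕ) [n.AtLeastTwo] => SpecializesTo.ofNat (V := V) n
  have hpb : SpecializesTo V D.pb.fst 0 := momentum_specializesTo_zero hz hzb.1 hl he rfl rfl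
  have hpbd : DualSpecializesTo V D.pb 0 := by
    refine ⟨by simpa using hpb, (((hj.mul hw').mul hpb).sub
      (((n 6).mul hκ).mul (hAab.add hBbb))).congr D.pb_snd.symm (by simp)⟩
  have hzμ : SpecializesTo V (D.zb.fst * (D.p.fst * D.z.fst⁻¹)) 0 := by
    obtain ⟨_, hl⟩ := SpecializesTo.exists_of_mem hl
    refine (hpb.add (hι.mul hl)).congr ?_ (by simp)
    field_simp; ring
  have hρ2 := D.ratio_sq_specializesTo hz hzb hb
  obtain ⟨R, hρ, hR⟩ := hρ2.exists_of_pow two_ne_zero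
  have hR' : R ^ 2 * (y - 1) = y + 1 := by rw [hR]; field_simp
  -- `p / z` is finite
  have hμ : D.p.fst * D.z.fst⁻¹ ∈ V := by
    by_contra hμ
    have hμ0 : D.p.fst * D.z.fst⁻¹ ≠ 0 := fun h => hμ (h ▸ V.zero_mem)
    have hν := SpecializesTo.inv_of_notMem hμ
    have hy : y = 0 := by
      refine hzb.unique ((hzμ.mul hν).congr ?_ (by simp))
      rw [mul_assoc, mul_inv_cancel₀ hμ0, mul_one]
    -- Velocities are rescaled by `z / p`, so that `p / z` becomes `1` while `w` and `pb` drop out.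
    have key := D.rigidity_deriv_fst_residue hj hz hzb ((hw'.mul hν).congr rfl (mul_zero _))
      (SpecializesTo.one.congr (mul_inv_cancel₀ hμ0).symm rfl)
      ((hpb.mul hν).congr rfl (mul_zero _)) hρ
    rw [hy] at key hR'
    have h1 : R ^ 3 = 1 := by linear_combination -key - 3 * R ^ 3 * hR'
    have h2 : R = -1 := by linear_combination -R * hR' - h1
    rw [h2] at hR'
    norm_num at hR'
  have hιd := D.inv_dualSpecializesTo_zero hz hj.1 hw'.1 hμ
  obtain ⟨M, hM⟩ := SpecializesTo.exists_of_mem hμ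
  -- Without forces the Riccati equation for `p / z` is `M' = -M ^ 2`.
  have hMd : DualSpecializesTo V (D.p * D.z⁻¹) (inl M + inr (-M ^ 2)) := by
    refine ⟨by simpa using hM, ?_⟩
    refine (((((n 6).neg.mul hκ).mul (hAa.add hBb)).mul hι).sub (hM.pow 2)).congr
      (D.p_div_snd_eq hz0).symm (by simp)
  have hzbd : DualSpecializesTo V D.zb (inl y + inr (j₀ * w₀ * y)) := by
    refine ⟨by simpa using hzb, ?_⟩
    exact (hpb.add ((hj.mul hw').mul hzb)).congr D.zb_snd.symm (by simp)
  have hρ2d := D.ratio_sq_dualSpecializesTo hz0 hιd hzbd (by simpa using hb)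
  have : NeZero (2 : IsLocalRing.ResidueField V) := ⟨two_ne_zero⟩
  obtain ⟨R', hρd, hRd⟩ := hρ2d.exists_of_sq (by simpa using ⟨ha, hb⟩)
  obtain rfl : R'.fst = R := hρd.1.unique hρ
  set Y : DualNumber (IsLocalRing.ResidueField V) := inl y + inr (j₀ * w₀ * y) with hY
  have hRd' : R' ^ 2 * (Y - 1) = Y + 1 := by
    rw [hRd, mul_assoc, TrivSqZeroExt.inv_mul_cancel (by simpa [hY] using hb), mul_one]
  have key := D.rigidity_deriv_residue hj hz0 hιd hzbd hw hMd hpbd (hρd.pow 3) (hρd.pow 5)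
  by_cases hy : y = 0
  · -- the third body at the centre of the pair
    have hY0 : Y = 0 := by rw [hY, hy]; simp
    rw [hY0] at key hRd'
    have h3 : R' ^ 3 = -R' := by linear_combination -R' * hRd'
    have h5 : R' ^ 5 = R' := by linear_combination -R' ^ 3 * hRd' - h3
    rw [h3, h5] at key
    -- Since `R ^ 2 = -1`, the first factor is a unit, so `M = -3 * j₀ * w₀` is stationary. Then `M'
    -- = -M ^ 2` forces `M = 0`, against `w₀ ≠ 0`.
    have h1 : (1 + R') * (inl M + inr (-M ^ 2) + 3 * inl j₀ * inl w₀) = 0 := by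
      linear_combination key
    have hfst := congrArg fst h1
    have hsnd := congrArg snd h1
    simp at hfst hsnd
    rw [hy] at hR'
    have hR0 : 1 + R'.fst ≠ 0 := fun h => by
      have : (2 : IsLocalRing.ResidueField V) = 0 := by
        linear_combination (1 - R'.fst) * h - hR'
      exact two_ne_zero this
    have hM0 := hfst.resolve_left hR0
    rw [hM0] at hsnd
    have hM2 : M = 0 := by simpa [hR0] using hsnd
    rw [hM2] at hM0
    simp [hj0, hw0] at hM0
  · have hM0 : M = 0 := by simpa [hy] using (hzb.mul hM).unique hzμ
    have hM1 : (inl M + inr (-M ^ 2) : DualNumber (IsLocalRing.ResidueField V)) = 0 := by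
      simp [hM0]
    rw [hM1] at key
    -- Multiplying by `R' ^ 2 - 1` eliminates `Y` through `R' ^ 2 * (Y - 1) = Y + 1`. The ratio thus
    -- satisfies a fixed polynomial to first order. It is not stationary, since `y' = j₀ * w₀ * y`
    -- is nonzero, so the root would be multiple.
    have h1 : 3 * inl j₀ * inl w₀ * (R' ^ 7 + 3 * R' ^ 5 - 3 * R' ^ 2 - 1) = 0 := by
      linear_combination -(R' ^ 2 - 1) * key + 6 * inl j₀ * inl w₀ * (1 - R' ^ 3) * hRd'
    have hfst := congrArg fst h1
    have hsnd := congrArg snd h1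
    have hsnd' := congrArg snd hRd'
    simp [snd_pow, hj0, hw0] at hfst hsnd
    simp [snd_pow, hY] at hsnd'
    have hR1 : R'.snd ≠ 0 := fun h => by
      rw [h] at hsnd'
      have h4 : (R'.fst ^ 2 - 1) * (j₀ * w₀ * y) = 0 := by linear_combination hsnd'
      have h5 : R'.fst ^ 2 - 1 = 0 := by simpa [hj0, hw0, hy] using h4
      have : (2 : IsLocalRing.ResidueField V) = 0 := by
        linear_combination (y - 1) * h5 - hR'
      exact two_ne_zero this
    refine separable_aux hfst (mul_right_cancel₀ hR1 ?_)
    linear_combination hsnd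

end RigidPairJet

end RigidPair

/-! ### Places on the isotropic lines through the rigid pair -/

section RigidPair

namespace RigidPairJet

variable {K : Type*} [Field K] {V : ValuationSubring K}

/-- Angular momentum divided by `z` shows that `zb * (p / z)` is small, and here `zb` is a unit. -/
theorem momentum_div_specializesTo_zero {z zb p pb : K} {y : IsLocalRing.ResidueField V}
    (hz : z ∉ V) (hzb : SpecializesTo V zb y) (hy : y ≠ 0) (hl : zb * p - z * pb ∈ V)
    (hpb : SpecializesTo V pb 0) : SpecializesTo V (p * z⁻¹) 0 := by
  have hz0 : z ≠ 0 := fun h => hz (h ▸ V.zero_mem)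
  have hzb0 := hzb.ne_zero hy
  obtain ⟨_, hl⟩ := SpecializesTo.exists_of_mem hl
  refine ((hzb.inv hy).mul (hpb.add ((SpecializesTo.inv_of_notMem hz).mul hl))).congr ?_ (by simp)
  field_simp; ring

/-- No place with `z` infinite on an isotropic line through one of the bodies. -/
theorem false_of_conj_eq_neg_one [CharZero (IsLocalRing.ResidueField V)] (D : RigidPairJet K)
    {κ₀ : IsLocalRing.ResidueField V} (hκ : SpecializesTo V D.κ κ₀) (hκ₀ : κ₀ ≠ 0)
    (hL : D.L ∈ V) (hE : D.E ∈ V) (hz : D.z.fst ∉ V) (hzb : SpecializesTo V D.zb.fst (-1)) :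
    False := by
  have hz0 : D.z.fst ≠ 0 := fun h => hz (h ▸ V.zero_mem)
  have hι := SpecializesTo.inv_of_notMem hz
  have hδ : SpecializesTo V (D.zb.fst + 1) 0 :=
    (hzb.add SpecializesTo.one).congr rfl (by simp)
  have hb : (-1 - 1 : IsLocalRing.ResidueField V) ≠ 0 := by norm_num
  have hbV : D.z.fst - 1 ∉ V := fun h => hz (by simpa using add_mem h V.one_mem)
  have haV : D.z.fst + 1 ∉ V := fun h => hz (by simpa using sub_mem h V.one_mem)
  have ha0 : D.z.fst + 1 ≠ 0 := fun h => haV (h ▸ V.zero_mem)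
  have hai := SpecializesTo.inv_of_notMem haV
  obtain ⟨hs, hB, hBb, hBbb⟩ := forces_specializeTo_zero D.s_ne D.s_sq
    (SpecializesTo.inv_of_notMem hbV) ((hzb.sub SpecializesTo.one).inv hb).1
  have hρ : SpecializesTo V D.ρ.fst 0 := SpecializesTo.zero_of_pow two_ne_zero
    ((D.ratio_sq_specializesTo hz hzb hb).congr rfl (by simp))
  obtain ⟨j₀, hj, hj₀⟩ := D.j_specializesTo (V := V)
  have hj0 : j₀ ≠ 0 := by rintro rfl; norm_num at hj₀
  have n := fun (n : ℕ) [n.AtLeastTwo] => SpecializesTo.ofNat (V := V) n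
  obtain ⟨_, hL⟩ := SpecializesTo.exists_of_mem hL
  obtain ⟨_, hE⟩ := SpecializesTo.exists_of_mem hE
  have hκK := hκ.ne_zero hκ₀
  -- This is the one force term that need not vanish, since `zb + 1` is small. The constraint
  -- expresses it by `w ^ 2`, and the conjugate force and the potential `r⁻¹` are multiples of it by
  -- small factors.
  set Q := D.r⁻¹ ^ 3 * (D.z.fst + 1) with hQ
  have hAab : D.r⁻¹ ^ 3 * (D.zb.fst + 1) = Q * (D.zb.fst + 1) * (D.z.fst + 1)⁻¹ := by
    rw [hQ]; field_simp
  have hrQ : D.r⁻¹ = Q * (D.zb.fst + 1) := by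
    rw [hQ, mul_assoc, ← D.r_sq]
    have := D.r_ne
    field_simp
  have hu : SpecializesTo V (1 + (D.zb.fst + 1) * (D.z.fst + 1)⁻¹) 1 :=
    (SpecializesTo.one.add (hδ.mul hai)).congr rfl (by simp)
  have hu0 := hu.ne_zero one_ne_zero
  have hQw : Q * (1 + (D.zb.fst + 1) * (D.z.fst + 1)⁻¹) =
      D.w.fst ^ 2 * D.κ⁻¹ - 1 + (D.s⁻¹ ^ 3 * (D.z.fst - 1) + D.s⁻¹ ^ 3 * (D.zb.fst - 1)) := by
    have := D.rigidity
    rw [hAab] at this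
    rw [this]
    field_simp
    ring
  by_cases hwV : D.w.fst ∈ V
  · obtain ⟨w₀, hw⟩ := SpecializesTo.exists_of_mem hwV
    have hQs : SpecializesTo V Q (w₀ ^ 2 * κ₀⁻¹ - 1) := by
      refine (((((hw.pow 2).mul (hκ.inv hκ₀)).sub SpecializesTo.one).add (hBb.add hBbb)).mul
        (hu.inv one_ne_zero)).congr ?_ (by simp)
      rw [← hQw, mul_inv_cancel_right₀ hu0]
    have hr : SpecializesTo V D.r⁻¹ 0 := (hQs.mul hδ).congr hrQ.symm (mul_zero _)
    have hl : D.zb.fst * D.p.fst - D.z.fst * D.pb.fst ∈ V :=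
      ((hL.sub (((n 6).mul hj).mul hw)).congr
        (by linear_combination -D.angular_momentum) rfl).1
    have he : D.p.fst * D.pb.fst ∈ V :=
      (((hE.add (((n 12).mul hκ).mul (hr.add hs))).sub ((n 3).mul (hw.pow 2))).congr
        (by linear_combination -D.energy) rfl).1
    have hpb : SpecializesTo V D.pb.fst 0 := momentum_specializesTo_zero hz hzb.1 hl he rfl rfl
    have hμ := momentum_div_specializesTo_zero hz hzb (by simp) hl hpb
    have key := D.rigidity_deriv_fst_residue (t := 1) hj hz hzb (by simpa using hw)
      (by simpa using hμ) (by simpa using hpb) hρ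
    -- With `y = -1`, `M = 0` and `R = 0`, only `3 * j₀ * w₀` is left of the relation. So `Q` tends
    -- to `-1`, and this nonzero force makes `w` vary to first order, contradicting the jet of the
    -- same relation.
    have hw0 : w₀ = 0 := by simpa [hj0] using key
    rw [hw0] at hw hQs
    replace hQs : SpecializesTo V Q (-1) := hQs.congr rfl (by simp)
    have hAab' := ((hQs.mul hδ).mul hai).congr hAab.symm (y' := 0) (by simp)
    have hιd := D.inv_dualSpecializesTo_zero hz hj.1 hw.1 hμ.1
    have hpbd : DualSpecializesTo V D.pb 0 :=
      ⟨by simpa using hpb, (((hj.mul hw).mul hpb).sub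
        (((n 6).mul hκ).mul (hAab'.add hBbb))).congr D.pb_snd.symm (by simp)⟩
    have hμd : DualSpecializesTo V (D.p * D.z⁻¹) 0 :=
      ⟨by simpa using hμ, (((((n 6).neg.mul hκ).mul (hQs.add hBb)).mul hι).sub
        (hμ.pow 2)).congr (D.p_div_snd_eq hz0).symm (by simp)⟩
    have hzbd : DualSpecializesTo V D.zb (-1) :=
      ⟨by simpa using hzb, (hpb.add ((hj.mul hw).mul hzb)).congr D.zb_snd.symm (by simp)⟩
    have hwd : DualSpecializesTo V D.w (inr (j₀ * κ₀ * (-1))) := by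
      refine ⟨by simpa using hw, ((hj.mul hκ).mul
        ((hQs.sub hAab').sub (hBb.sub hBbb))).congr ?_ (by simp)⟩
      rw [D.w_snd, hQ]; ring
    have hρ2d : DualSpecializesTo V (D.ρ ^ 2) 0 :=
      (D.ratio_sq_dualSpecializesTo hz0 hιd hzbd (by simpa using hb)).congr rfl (by simp)
    -- The derivative of `ρ` may be infinite, because `ρ` vanishes at the place, but that of `ρ ^ 3`
    -- is `3 / 2 * ρ` times that of `ρ ^ 2`.
    have hρ3d : DualSpecializesTo V (D.ρ ^ 3) 0 := by
      refine ⟨(hρ.pow 3).congr (by simp) (by simp), ?_⟩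
      have h32 := ((n 2).inv two_ne_zero).mul (((n 3).mul hρ).mul hρ2d.2)
      refine h32.congr ?_ (by simp)
      have : (2 : K) ≠ 0 := (n 2).ne_zero two_ne_zero
      simp [snd_pow]
      field_simp
    have hρ5d : DualSpecializesTo V (D.ρ ^ 5) 0 :=
      (hρ3d.mul hρ2d).congr (by ring) (by simp)
    have key2 := D.rigidity_deriv_residue hj hz0 hιd hzbd hwd hμd hpbd hρ3d hρ5d
    have h := congrArg snd key2
    simp [hj0, hκ₀] at h
  -- When `w` is infinite, all velocities are measured in units of `w`; the leading term `3 * j₀` is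
  -- then already contradictory, without derivatives.
  · have hw0 : D.w.fst ≠ 0 := fun h => hwV (h ▸ V.zero_mem)
    have hν := SpecializesTo.inv_of_notMem hwV
    have hQs : SpecializesTo V (Q * D.w.fst⁻¹ ^ 2) κ₀⁻¹ := by
      refine (((hκ.inv hκ₀).add ((hν.pow 2).mul ((hBb.add hBbb).sub SpecializesTo.one))).mul
        (hu.inv one_ne_zero)).congr ?_ (by simp)
      rw [mul_inv_eq_iff_eq_mul₀ hu0, mul_right_comm, hQw]
      field_simp
      ring
    have hl : D.zb.fst * (D.p.fst * D.w.fst⁻¹) - D.z.fst * (D.pb.fst * D.w.fst⁻¹) ∈ V := by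
      refine (((hL.mul hν).sub ((n 6).mul hj)).congr ?_ rfl).1
      rw [← D.angular_momentum]; field_simp; ring
    have he : (D.p.fst * D.w.fst⁻¹) * (D.pb.fst * D.w.fst⁻¹) ∈ V := by
      refine ((((hE.mul (hν.pow 2)).add (((n 12).mul hκ).mul ((hQs.mul hδ).add
        (hs.mul (hν.pow 2))))).sub (n 3)).congr ?_ rfl).1
      rw [← D.energy, hrQ]; field_simp; ring
    have hpb := momentum_specializesTo_zero hz hzb.1 hl he rfl rfl
    have hμ := momentum_div_specializesTo_zero hz hzb (by simp) hl hpb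
    have key := D.rigidity_deriv_fst_residue hj hz hzb
      (SpecializesTo.one.congr (mul_inv_cancel₀ hw0).symm rfl)
      (hμ.congr (mul_right_comm _ _ _) rfl) hpb hρ
    simp [hj0] at key

end RigidPairJet

end RigidPair

/-! ### Places with both `z` and `zb` infinite -/

section RigidPair

namespace RigidPairJet

variable {K : Type*} [Field K] {V : ValuationSubring K}

/-- For finite `x` one has `x ^ 2 = x * (x - y) + x * y`. An infinite `x` is excluded by `x = (x -
y) + (x * y) * x⁻¹ + (y - x * y * x⁻¹)`, whose last bracket is zero. -/
theorem specializesTo_zero_of_sub_of_mul {x y : K} (h : SpecializesTo V (x - y) 0)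
    (h' : SpecializesTo V (x * y) 0) : SpecializesTo V x 0 := by
  by_cases hx : x ∈ V
  · obtain ⟨_, hx⟩ := SpecializesTo.exists_of_mem hx
    exact SpecializesTo.zero_of_pow two_ne_zero
      (((hx.mul h).add h').congr (by ring) (by simp))
  · have hx0 : x ≠ 0 := fun h => hx (h ▸ V.zero_mem)
    refine absurd (h.add (h'.mul (SpecializesTo.inv_of_notMem hx))).1 ?_
    rwa [mul_right_comm, mul_inv_cancel₀ hx0, one_mul, sub_add_cancel]

/-- No place with both `z` and `zb` infinite, `z` at most of the order of `zb`. -/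
theorem false_of_conj_infinite_of_le [CharZero (IsLocalRing.ResidueField V)] (D : RigidPairJet K)
    {κ₀ : IsLocalRing.ResidueField V} (hκ : SpecializesTo V D.κ κ₀) (hκ₀ : κ₀ ≠ 0)
    (hL : D.L ∈ V) (hE : D.E ∈ V) (hz : D.z.fst ∉ V) (hzb : D.zb.fst ∉ V)
    (hle : D.z.fst * D.zb.fst⁻¹ ∈ V) : False := by
  have hz0 : D.z.fst ≠ 0 := fun h => hz (h ▸ V.zero_mem)
  have hzb0 : D.zb.fst ≠ 0 := fun h => hzb (h ▸ V.zero_mem)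
  have hι := SpecializesTo.inv_of_notMem hz
  have hιb := SpecializesTo.inv_of_notMem hzb
  have ha := (SpecializesTo.inv_of_notMem
    (fun h => hzb (by simpa using sub_mem h V.one_mem) : D.zb.fst + 1 ∉ V)).1
  have hb := (SpecializesTo.inv_of_notMem
    (fun h => hzb (by simpa using add_mem h V.one_mem) : D.zb.fst - 1 ∉ V)).1
  obtain ⟨⟨-, -, hAa, hAab⟩, -, -, hBb, hBbb⟩ := D.far_forces hz ha hb
  obtain ⟨w₀, hw, hw₀⟩ := D.far_angular_velocity hκ hz ha hb
  have hw' : SpecializesTo V D.w.fst w₀ := by simpa using hw.1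
  have hw0 : w₀ ≠ 0 := by rintro rfl; apply hκ₀; rw [← hw₀]; simp
  obtain ⟨hl, he⟩ := D.far_integrals hκ.1 hL hE hz ha hb
  obtain ⟨_, hl⟩ := SpecializesTo.exists_of_mem hl
  obtain ⟨_, he⟩ := SpecializesTo.exists_of_mem he
  obtain ⟨j₀, hj, hj₀⟩ := D.j_specializesTo (V := V)
  have hj0 : j₀ ≠ 0 := by rintro rfl; norm_num at hj₀
  have n := fun (n : ℕ) [n.AtLeastTwo] => SpecializesTo.ofNat (V := V) n
  -- both velocities are small relative to the positions
  have hsub : SpecializesTo V (D.p.fst * D.z.fst⁻¹ - D.pb.fst * D.zb.fst⁻¹) 0 :=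
    ((hl.mul (hι.mul hιb))).congr (by field_simp) (by simp)
  have hmul : SpecializesTo V (D.p.fst * D.z.fst⁻¹ * (D.pb.fst * D.zb.fst⁻¹)) 0 :=
    ((he.mul (hι.mul hιb))).congr (by field_simp) (by simp)
  have hμ := specializesTo_zero_of_sub_of_mul hsub hmul
  have hμb : SpecializesTo V (D.pb.fst * D.zb.fst⁻¹) 0 :=
    (hμ.sub hsub).congr (by ring) (by simp)
  have hιd := D.inv_dualSpecializesTo_zero hz hj.1 hw'.1 hμ.1
  have hιbd : DualSpecializesTo V D.zb⁻¹ 0 :=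
    D.conj.inv_dualSpecializesTo_zero hzb hj.neg.1 hw'.1 hμb.1
  have hμd : DualSpecializesTo V (D.p * D.z⁻¹) 0 :=
    ⟨by simpa using hμ, (((((n 6).neg.mul hκ).mul (hAa.add hBb)).mul hι).sub
      (hμ.pow 2)).congr (D.p_div_snd_eq hz0).symm (by simp)⟩
  have hμbd : DualSpecializesTo V (D.pb * D.zb⁻¹) 0 :=
    ⟨by simpa using hμb, (((((n 6).neg.mul hκ).mul (hAab.add hBbb)).mul hιb).sub
      (hμb.pow 2)).congr (D.conj.p_div_snd_eq hzb0).symm (by simp)⟩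
  obtain ⟨x, hx⟩ := SpecializesTo.exists_of_mem hle
  -- In the rotating frame `z` and `zb` turn in opposite senses, so `z / zb` turns at twice the rate
  -- `w₀`. It can be stationary only if `x = 0`, and both cases below contradict this.
  set X : DualNumber (IsLocalRing.ResidueField V) := inl x + inr (-2 * j₀ * w₀ * x) with hX
  have hXd : DualSpecializesTo V (D.z * D.zb⁻¹) X := by
    refine ⟨by simpa [hX] using hx, ?_⟩
    refine (hx.mul ((hμ.sub hμb).sub (((n 2).mul hj).mul hw'))).congr ?_ (by simp [hX]; ring)
    simp [D.z_snd, D.zb_snd]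
    field_simp
    ring
  have zι := TrivSqZeroExt.mul_inv_cancel hz0
  have zιb := TrivSqZeroExt.mul_inv_cancel hzb0
  have hα : DualSpecializesTo V ((D.z + 1) * D.z⁻¹) 1 :=
    (DualSpecializesTo.one.add hιd).congr (by linear_combination -zι) (add_zero 1)
  have hβ : DualSpecializesTo V ((D.z - 1) * D.z⁻¹) 1 :=
    (DualSpecializesTo.one.sub hιd).congr (by linear_combination -zι) (sub_zero 1)
  have hαb : DualSpecializesTo V ((D.zb + 1) * D.zb⁻¹) 1 :=
    (DualSpecializesTo.one.add hιbd).congr (by linear_combination -zιb) (add_zero 1)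
  have hβb : DualSpecializesTo V ((D.zb - 1) * D.zb⁻¹) 1 :=
    (DualSpecializesTo.one.sub hιbd).congr (by linear_combination -zιb) (sub_zero 1)
  have hd : DualSpecializesTo V ((D.z - D.zb) * D.zb⁻¹) (X - 1) :=
    (hXd.sub DualSpecializesTo.one).congr (by linear_combination zιb) rfl
  have ht : DualSpecializesTo V ((D.z + D.zb) * D.zb⁻¹) (X + 1) :=
    (hXd.add DualSpecializesTo.one).congr (by linear_combination -zιb) rfl
  have hP : DualSpecializesTo V ((D.p + D.pb) * D.zb⁻¹) 0 :=
    ((hμd.mul hXd).add hμbd).congr (by linear_combination D.p * D.zb⁻¹ * zι) (by simp)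
  have hββ := hβ.mul hβb
  have hββi := hββ.inv (by simp)
  have hββ1 := TrivSqZeroExt.mul_inv_cancel (hββ.1.ne_zero (by simp))
  have hρ2 : DualSpecializesTo V (D.ρ ^ 2) 1 := by
    refine ((hα.mul hαb).mul hββi).congr ?_ (by simp)
    linear_combination D.ρ ^ 2 * hββ1 -
      D.z⁻¹ * D.zb⁻¹ * ((D.z - 1) * D.z⁻¹ * ((D.zb - 1) * D.zb⁻¹))⁻¹ * D.ρ_sq
  have : NeZero (2 : IsLocalRing.ResidueField V) := ⟨two_ne_zero⟩
  obtain ⟨R, hρ, hR⟩ := hρ2.exists_of_sq (by simp)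
  have hJ := DualSpecializesTo.inl hj
  have N := fun (n : ℕ) [n.AtLeastTwo] => DualSpecializesTo.ofNat (V := V) n
  have hR1 : R = 1 ∨ R = -1 := by
    have h1 := congrArg fst hR
    have h2 := congrArg snd hR
    simp [snd_pow] at h1 h2
    rcases h1 with h1 | h1
    · left; ext <;> simp [h1] at h2 ⊢; exact h2
    · right; ext <;> simp [h1] at h2 ⊢; exact h2
  rcases hR1 with rfl | rfl
  · -- the two distances are asymptotic to each other
    -- Here the leading terms of the relation cancel, so the next order is needed: `1 - ρ ^ n` is of
    -- order `z⁻¹`. Finiteness of `z / zb` keeps its coefficient finite.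
    have hT : DualSpecializesTo V (D.z * (1 - D.ρ ^ 2)) (-2 * (X + 1)) := by
      refine (((N 2).neg.mul ht).mul hββi).congr ?_ (by simp)
      have h0 : (1 - D.ρ ^ 2) * ((D.z - 1) * (D.zb - 1)) = -2 * (D.z + D.zb) := by
        linear_combination -D.ρ_sq
      generalize ((D.z - 1) * D.z⁻¹ * ((D.zb - 1) * D.zb⁻¹))⁻¹ = B at *
      linear_combination (D.z * (1 - D.ρ ^ 2)) * hββ1 - D.z * D.z⁻¹ * D.zb⁻¹ * B * h0
        + 2 * D.zb⁻¹ * B * (D.z + D.zb) * zι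
    have hρ1 := DualSpecializesTo.one.add hρ
    have h11 : (1 + 1 : DualNumber (IsLocalRing.ResidueField V)).fst ≠ 0 := by
      simp [one_add_one_eq_two]
    have hρi := hρ1.inv h11
    have hρi1 := TrivSqZeroExt.mul_inv_cancel (hρ1.1.ne_zero h11)
    have h2i := TrivSqZeroExt.mul_inv_cancel h11
    have hU3 : DualSpecializesTo V (D.z * (1 - D.ρ ^ 3)) (-3 * (X + 1)) := by
      refine ((hT.mul ((DualSpecializesTo.one.add hρ).add (hρ.pow 2))).mul hρi).congr ?_ ?_
      · linear_combination D.z * (1 - D.ρ ^ 3) * hρi1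
      · linear_combination -3 * (X + 1) * h2i
    have hU5 : DualSpecializesTo V (D.z * (1 - D.ρ ^ 5)) (-5 * (X + 1)) := by
      refine ((hT.mul ((((DualSpecializesTo.one.add hρ).add (hρ.pow 2)).add
        (hρ.pow 3)).add (hρ.pow 4))).mul hρi).congr ?_ ?_
      · linear_combination D.z * (1 - D.ρ ^ 5) * hρi1
      · linear_combination -5 * (X + 1) * h2i
    have hS := hμd.add hμbd
    have he' := hP.sub ((hJ.mul hw).mul hd)
    have h5 := DualSpecializesTo.one.add (hρ.pow 5)
    have h5' := DualSpecializesTo.one.sub (hρ.pow 5)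
    have lhs := (((((N 6).mul hJ).mul hw).mul hU3).mul hd).mul (hα.mul hαb)
    have rhs := (((N 3).neg.mul hS).mul ((ht.mul hU5).add ((hXd.mul (N 2)).mul h5))).sub
      (((N 3).mul he').mul ((ht.mul h5).add ((hιbd.mul (N 2)).mul h5'))) |>.add
      ((((N 2).mul hU3).mul (hα.mul hαb)).mul hP)
    have key := lhs.unique (rhs.congr ?_ rfl)
    -- The left side contributes `-18` and the right side `6` times `j₀ * w₀ * (X ^ 2 - 1)`.
    · have h24 : 24 * inl j₀ * inl w₀ * (X ^ 2 - 1) = 0 := by linear_combination -key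
      have h1 := congrArg fst h24
      have h2 := congrArg snd h24
      simp [hX, hj0, hw0, snd_pow] at h1 h2
      rw [h2] at h1
      norm_num at h1
    · generalize D.z⁻¹ = ι at *
      generalize D.zb⁻¹ = ιb at *
      linear_combination -ιb ^ 2 * D.rigidity_deriv
        + (-3 * ((D.z + D.zb) * (1 - D.ρ ^ 5) + 2 * (1 + D.ρ ^ 5)) * D.p * ιb
          + 2 * (1 - D.ρ ^ 3) * ((D.z + 1) * (D.zb + 1)) * (D.p + D.pb) * ιb ^ 2
          - 6 * inl D.j * D.w * (1 - D.ρ ^ 3) * (D.z - D.zb) * ((D.z + 1) * (D.zb + 1)) * ιb ^ 2) * zι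
        + 3 * ((D.z + D.zb) * (1 - D.ρ ^ 5) + 2 * (1 + D.ρ ^ 5)) * D.p * ιb * zιb
  · -- the two distances are asymptotic up to a sign
    have hn := ((hμd.mul hαb).add (hμbd.mul hα)).sub ((hJ.mul hw).mul (hd.mul hιd))
    have hn' := ((hμd.mul hβb).add (hμbd.mul hβ)).add ((hJ.mul hw).mul (hd.mul hιd))
    have h3 := DualSpecializesTo.one.sub (hρ.pow 3)
    have lhs := (((((N 6).mul hJ).mul hw).mul h3).mul hd).mul (hα.mul hαb)
    have rhs := ((((N 3).neg.mul hn).mul (ht.add ((N 2).mul hιbd))).add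
      (((N 3).mul (hρ.pow 5)).mul hn' |>.mul (ht.sub ((N 2).mul hιbd)))).add
      (((N 2).mul h3).mul (hα.mul hαb) |>.mul hP)
    have key := lhs.unique (rhs.congr
      (by linear_combination -D.z⁻¹ * D.zb⁻¹ ^ 2 * D.rigidity_deriv) rfl)
    have h12 : 12 * inl j₀ * inl w₀ * (X - 1) = 0 := by linear_combination key
    have h1 := congrArg fst h12
    have h2 := congrArg snd h12
    simp [hX, hj0, hw0] at h1 h2
    rw [h2] at h1
    simp at h1

/-- The position of the third body relative to the rigid pair is finite at every place. -/
theorem z_fst_mem [CharZero (IsLocalRing.ResidueField V)] (D : RigidPairJet K)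
    {κ₀ : IsLocalRing.ResidueField V} (hκ : SpecializesTo V D.κ κ₀) (hκ₀ : κ₀ ≠ 0)
    (hL : D.L ∈ V) (hE : D.E ∈ V) : D.z.fst ∈ V := by
  by_contra hz
  by_cases hzb : D.zb.fst ∈ V
  · obtain ⟨y, hy⟩ := SpecializesTo.exists_of_mem hzb
    by_cases ha : y + 1 = 0
    · exact D.false_of_conj_eq_neg_one hκ hκ₀ hL hE hz (eq_neg_of_add_eq_zero_left ha ▸ hy)
    by_cases hb : y - 1 = 0
    · rw [sub_eq_zero.1 hb] at hy
      exact D.swap.false_of_conj_eq_neg_one hκ hκ₀ hL hE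
        (fun h => hz (by simpa [swap] using h)) (by simpa [swap] using hy.neg)
    exact D.false_of_conj_finite hκ hκ₀ hL hE hz hy ha hb
  · rcases V.mem_or_inv_mem (D.z.fst * D.zb.fst⁻¹) with h | h
    · exact D.false_of_conj_infinite_of_le hκ hκ₀ hL hE hz hzb h
    · exact D.conj.false_of_conj_infinite_of_le hκ hκ₀ (V.neg_mem _ hL) hE hzb hz
        (by rwa [mul_inv, inv_inv, mul_comm] at h)

end RigidPairJet

end RigidPair

/-! ### Existence of a place where a nonconstant function is infinite -/

section Places

theorem IsAlgClosed.mem_range_of_isIntegral_range {k K : Type*} [Field k] [IsAlgClosed k] [Field K]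
    (c : k →+* K) {x : K} (hx : IsIntegral c.range x) : x ∈ c.range := by
  algebraize [c, c.rangeRestrict]
  have : IsScalarTower k c.range K := IsScalarTower.of_algebraMap_eq fun _ => rfl
  have : Algebra.IsIntegral k c.range :=
    Algebra.isIntegral_def.2 fun y => by
      obtain ⟨a, rfl⟩ := c.rangeRestrict_surjective y
      exact isIntegral_algebraMap
  have h : IsIntegral k x := isIntegral_trans x hx
  exact minpoly.mem_range_of_degree_eq_one k x
    (IsAlgClosed.degree_eq_one_of_irreducible k (minpoly.irreducible h))

/-- A function with infinitely many values on `I` has a pole at some place of a field into which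
the functions on `I` are mapped. -/
theorem exists_place_of_infinite_image {I : Set ℝ} {z : ℝ → ℂ} (hz : (z '' I).Infinite) :
    ∃ (K : Type) (_ : Field K) (φ : (ℝ → ℂ) →+* K) (V : ValuationSubring K),
      (∀ f g : ℝ → ℂ, (∀ t ∈ I, f t = g t) → φ f = φ g) ∧ (∀ f, φ f⁻¹ = (φ f)⁻¹) ∧
      (∀ c : ℂ, φ (fun _ => c) ∈ V) ∧ φ z ∉ V := by
  -- Along this filter `z` eventually avoids each single value, and the infinite image makes the
  -- filter proper.
  have hne : (Filter.comap z Filter.cofinite ⊓ Filter.principal I).NeBot := by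
    refine Filter.inf_principal_neBot_iff.2 fun U hU => ?_
    obtain ⟨T, hT, hTU⟩ := Filter.mem_comap.1 hU
    obtain ⟨_, ⟨t, ht, rfl⟩, hy⟩ := (hz.sdiff (Filter.mem_cofinite.1 hT)).nonempty
    exact ⟨t, hTU (by simpa using hy), ht⟩
  let u := Ultrafilter.of (Filter.comap z Filter.cofinite ⊓ Filter.principal I)
  have hu : (u : Filter ℝ) ≤ Filter.comap z Filter.cofinite ⊓ Filter.principal I :=
    Ultrafilter.of_le _
  let φ : (ℝ → ℂ) →+* Filter.Germ (u : Filter ℝ) ℂ := Filter.Germ.coeRingHom (u : Filter ℝ)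
  let c : ℂ →+* Filter.Germ (u : Filter ℝ) ℂ := φ.comp (Pi.constRingHom ℝ ℂ)
  have hI : I ∈ (u : Filter ℝ) := (hu.trans inf_le_right) (Filter.mem_principal_self I)
  have hzc : φ z ∉ c.range := by
    rintro ⟨a, ha⟩
    have h1 : ∀ᶠ t in (u : Filter ℝ), a = z t := Filter.Germ.coe_eq.1 ha
    have h2 : ∀ᶠ t in (u : Filter ℝ), z t ≠ a :=
      (hu.trans inf_le_left) (Filter.preimage_mem_comap (by simp : {a}ᶜ ∈ Filter.cofinite))
    obtain ⟨t, h3, h4⟩ := (h1.and h2).exists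
    exact h4 h3.symm
  have : IsIntegrallyClosedIn c.range (Filter.Germ (u : Filter ℝ) ℂ) :=
    Subring.isIntegrallyClosedIn_iff.2 fun x hx =>
      IsAlgClosed.mem_range_of_isIntegral_range c hx
  obtain ⟨V, hV, hzV⟩ := Subring.exists_le_valuationSubring_of_isIntegrallyClosedIn hzc
  exact ⟨_, inferInstance, φ, V,
    fun f g h => Filter.Germ.coe_eq.2 (Filter.mem_of_superset hI h), fun f => rfl,
    fun a => hV ⟨a, rfl⟩, hzV⟩

end Places

/-! ### Jets of differentiable functions -/

section Jets

/-- Functoriality of dual numbers. -/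
def DualNumber.mapRingHom {R S : Type*} [CommRing R] [CommRing S] (f : R →+* S) :
    DualNumber R →+* DualNumber S where
  toFun x := inl (f x.fst) + inr (f x.snd)
  map_one' := by ext <;> simp
  map_mul' x y := by ext <;> simp
  map_zero' := by ext <;> simp
  map_add' x y := by ext <;> simp

@[simp]
theorem DualNumber.fst_mapRingHom {R S : Type*} [CommRing R] [CommRing S] (f : R →+* S)
    (x : DualNumber R) : (DualNumber.mapRingHom f x).fst = f x.fst := by
  simp [DualNumber.mapRingHom]

@[simp]
theorem DualNumber.snd_mapRingHom {R S : Type*} [CommRing R] [CommRing S] (f : R →+* S)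
    (x : DualNumber R) : (DualNumber.mapRingHom f x).snd = f x.snd := by
  simp [DualNumber.mapRingHom]

@[simp]
theorem DualNumber.mapRingHom_inl {R S : Type*} [CommRing R] [CommRing S] (f : R →+* S) (x : R) :
    DualNumber.mapRingHom f (inl x) = inl (f x) := by
  ext <;> simp

/-- The pairs of a function and its derivative on `I`. -/
def jetSubring (I : Set ℝ) : Subring (DualNumber (ℝ → ℂ)) where
  carrier := {x | ∀ t ∈ I, HasDerivAt x.fst (x.snd t) t}
  mul_mem' {x y} hx hy t ht := by
    have := (hx t ht).mul (hy t ht)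
    simp only [fst_mul, snd_mul]
    refine this.congr_deriv ?_
    simp [mul_comm]
    ring
  one_mem' t ht := by simpa using! hasDerivAt_const t (1 : ℂ)
  add_mem' {x y} hx hy t ht := by simpa using (hx t ht).add (hy t ht)
  zero_mem' t ht := by simp
  neg_mem' {x} hx t ht := by simpa using (hx t ht).neg

theorem mem_jetSubring {I : Set ℝ} {f f' : ℝ → ℂ} (h : ∀ t ∈ I, HasDerivAt f (f' t) t) :
    (inl f + inr f' : DualNumber (ℝ → ℂ)) ∈ jetSubring I := fun t ht => by
  simpa using h t ht

/-- Jets of functions that agree on an open set agree there. -/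
theorem mapRingHom_eq_of_mem_jetSubring {I : Set ℝ} (hI : IsOpen I) {K : Type*} [CommRing K]
    {φ : (ℝ → ℂ) →+* K} (hφ : ∀ f g : ℝ → ℂ, (∀ t ∈ I, f t = g t) → φ f = φ g)
    {x y : DualNumber (ℝ → ℂ)} (hx : x ∈ jetSubring I) (hy : y ∈ jetSubring I)
    (h : ∀ t ∈ I, x.fst t = y.fst t) : DualNumber.mapRingHom φ x = DualNumber.mapRingHom φ y := by
  ext
  · simpa using hφ _ _ h
  · simp only [DualNumber.snd_mapRingHom]
    refine hφ _ _ fun t ht => (hx t ht).unique ((hy t ht).congr_of_eventuallyEq ?_)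
    filter_upwards [hI.mem_nhds ht] with s hs using h s hs

theorem hasDerivAt_complex_norm {a : ℝ → ℂ} {a' : ℂ} {t : ℝ} (h : HasDerivAt a a' t)
    (ha : a t ≠ 0) : HasDerivAt (fun t => (‖a t‖ : ℂ))
      ((a' * starRingEnd ℂ (a t) + a t * starRingEnd ℂ a') / (2 * ‖a t‖)) t := by
  have h1 := h.norm_sq.sqrt (by simpa using ha)
  simp only [Real.sqrt_sq (norm_nonneg _)] at h1
  refine h1.ofReal_comp.congr_deriv ?_
  have h2 : a' * starRingEnd ℂ (a t) + a t * starRingEnd ℂ a' =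
      ((2 * inner ℝ (a t) a' : ℝ) : ℂ) := by
    rw [Complex.inner]
    apply Complex.ext <;> simp <;> ring
  rw [h2]; push_cast; rfl

end Jets

/-! ### Equations of motion in the frame of the pair, and their consequences -/

section Motion

open ComplexConjugate

/-- The motion of three equal masses two of which keep their distance, in the frame in which these
two rest at `1` and `-1`: `z` is the position and `p` the inertial velocity of the third body, and
`w` is the angular velocity of the frame. -/
structure IsRigidPairMotion (I : Set ℝ) (κ : ℝ) (z p : ℝ → ℂ) (w : ℝ → ℝ) : Prop where
  add_one_ne : ∀ t ∈ I, z t + 1 ≠ 0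
  sub_one_ne : ∀ t ∈ I, z t - 1 ≠ 0
  hasDerivAt_z : ∀ t ∈ I, HasDerivAt z (p t - Complex.I * w t * z t) t
  hasDerivAt_p : ∀ t ∈ I, HasDerivAt p (-(Complex.I * w t * p t) - 6 * κ *
    ((‖z t + 1‖ : ℂ)⁻¹ ^ 3 * (z t + 1) + (‖z t - 1‖ : ℂ)⁻¹ ^ 3 * (z t - 1))) t
  hasDerivAt_w : ∀ t ∈ I, HasDerivAt (fun t => (w t : ℂ)) (Complex.I * κ *
    (((‖z t + 1‖ : ℂ)⁻¹ ^ 3 - (‖z t - 1‖ : ℂ)⁻¹ ^ 3) * (z t - conj (z t)))) t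
  rigidity : ∀ t ∈ I, (w t : ℂ) ^ 2 = κ * (1 +
    ((‖z t + 1‖ : ℂ)⁻¹ ^ 3 * (z t + 1) + (‖z t + 1‖ : ℂ)⁻¹ ^ 3 * (conj (z t) + 1))
    - ((‖z t - 1‖ : ℂ)⁻¹ ^ 3 * (z t - 1) + (‖z t - 1‖ : ℂ)⁻¹ ^ 3 * (conj (z t) - 1)))

theorem exists_eq_of_hasDerivAt_zero {I : Set ℝ} (hIo : IsOpen I) (hIc : IsPreconnected I)
    {E : Type*} [NormedAddCommGroup E] [NormedSpace ℝ E]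
    {f : ℝ → E} (h : ∀ t ∈ I, HasDerivAt f 0 t) : ∃ c, ∀ t ∈ I, f t = c :=
  hIo.exists_is_const_of_deriv_eq_zero hIc
    (fun t ht => (h t ht).differentiableAt.differentiableWithinAt) fun t ht => (h t ht).deriv

namespace IsRigidPairMotion

variable {I : Set ℝ} {κ : ℝ} {z p : ℝ → ℂ} {w : ℝ → ℝ}

theorem norm_add_one_ne (h : IsRigidPairMotion I κ z p w) {t : ℝ} (ht : t ∈ I) :
    (‖z t + 1‖ : ℂ) ≠ 0 := by simpa using h.add_one_ne t ht

theorem norm_sub_one_ne (h : IsRigidPairMotion I κ z p w) {t : ℝ} (ht : t ∈ I) :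
    (‖z t - 1‖ : ℂ) ≠ 0 := by simpa using h.sub_one_ne t ht

theorem norm_add_one_sq (z : ℂ) : (‖z + 1‖ : ℂ) ^ 2 = (z + 1) * (conj z + 1) := by
  rw [← Complex.ofReal_pow, ← Complex.normSq_eq_norm_sq, Complex.normSq_eq_conj_mul_self]
  simp [mul_comm]

theorem norm_sub_one_sq (z : ℂ) : (‖z - 1‖ : ℂ) ^ 2 = (z - 1) * (conj z - 1) := by
  rw [← Complex.ofReal_pow, ← Complex.normSq_eq_norm_sq, Complex.normSq_eq_conj_mul_self]
  simp [mul_comm]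

theorem hasDerivAt_conj_z (h : IsRigidPairMotion I κ z p w) {t : ℝ} (ht : t ∈ I) :
    HasDerivAt (fun t => conj (z t)) (conj (p t) + Complex.I * w t * conj (z t)) t :=
  (h.hasDerivAt_z t ht).star.congr_deriv (by simp)

theorem hasDerivAt_conj_p (h : IsRigidPairMotion I κ z p w) {t : ℝ} (ht : t ∈ I) :
    HasDerivAt (fun t => conj (p t)) (Complex.I * w t * conj (p t) - 6 * κ *
      ((‖z t + 1‖ : ℂ)⁻¹ ^ 3 * (conj (z t) + 1) + (‖z t - 1‖ : ℂ)⁻¹ ^ 3 * (conj (z t) - 1))) t :=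
  (h.hasDerivAt_p t ht).star.congr_deriv (by simp)

theorem hasDerivAt_norm_add_one (h : IsRigidPairMotion I κ z p w) {t : ℝ} (ht : t ∈ I) :
    HasDerivAt (fun t => (‖z t + 1‖ : ℂ)) ((p t * (conj (z t) + 1) + conj (p t) * (z t + 1)
      - Complex.I * w t * (z t - conj (z t))) / (2 * ‖z t + 1‖)) t := by
  refine (hasDerivAt_complex_norm ((h.hasDerivAt_z t ht).add_const 1)
    (h.add_one_ne t ht)).congr_deriv ?_
  congr 1
  simp
  ring

theorem hasDerivAt_norm_sub_one (h : IsRigidPairMotion I κ z p w) {t : ℝ} (ht : t ∈ I) :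
    HasDerivAt (fun t => (‖z t - 1‖ : ℂ)) ((p t * (conj (z t) - 1) + conj (p t) * (z t - 1)
      + Complex.I * w t * (z t - conj (z t))) / (2 * ‖z t - 1‖)) t := by
  refine (hasDerivAt_complex_norm ((h.hasDerivAt_z t ht).sub_const 1)
    (h.sub_one_ne t ht)).congr_deriv ?_
  congr 1
  simp
  ring

theorem hasDerivAt_inv_norm_add_one (h : IsRigidPairMotion I κ z p w) {t : ℝ} (ht : t ∈ I) :
    HasDerivAt (fun t => (‖z t + 1‖ : ℂ)⁻¹) (-((‖z t + 1‖ : ℂ)⁻¹ ^ 3 *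
      (p t * (conj (z t) + 1) + conj (p t) * (z t + 1)
      - Complex.I * w t * (z t - conj (z t)))) / 2) t := by
  refine ((h.hasDerivAt_norm_add_one ht).fun_inv (h.norm_add_one_ne ht)).congr_deriv ?_
  have := h.norm_add_one_ne ht
  field_simp

theorem hasDerivAt_inv_norm_sub_one (h : IsRigidPairMotion I κ z p w) {t : ℝ} (ht : t ∈ I) :
    HasDerivAt (fun t => (‖z t - 1‖ : ℂ)⁻¹) (-((‖z t - 1‖ : ℂ)⁻¹ ^ 3 *
      (p t * (conj (z t) - 1) + conj (p t) * (z t - 1)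
      + Complex.I * w t * (z t - conj (z t)))) / 2) t := by
  refine ((h.hasDerivAt_norm_sub_one ht).fun_inv (h.norm_sub_one_ne ht)).congr_deriv ?_
  have := h.norm_sub_one_ne ht
  field_simp

/-- The term in `w` is the pair's own angular momentum; the factor `6` reflects the reduced masses
of equal bodies. -/
theorem exists_angular_momentum_eq (h : IsRigidPairMotion I κ z p w) (hIo : IsOpen I)
    (hIc : IsPreconnected I) : ∃ L : ℂ, ∀ t ∈ I,
      conj (z t) * p t - z t * conj (p t) + 6 * Complex.I * w t = L := by
  refine exists_eq_of_hasDerivAt_zero hIo hIc fun t ht => ?_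
  refine ((((h.hasDerivAt_conj_z ht).fun_mul (h.hasDerivAt_p t ht)).fun_sub
    ((h.hasDerivAt_z t ht).fun_mul (h.hasDerivAt_conj_p ht))).fun_add
    ((h.hasDerivAt_w t ht).const_mul (6 * Complex.I))).congr_deriv ?_
  linear_combination (6 * κ * (((‖z t + 1‖ : ℂ)⁻¹ ^ 3 - (‖z t - 1‖ : ℂ)⁻¹ ^ 3) *
    (z t - conj (z t)))) * Complex.I_sq

theorem exists_energy_eq (h : IsRigidPairMotion I κ z p w) (hIo : IsOpen I)
    (hIc : IsPreconnected I) : ∃ E : ℂ, ∀ t ∈ I,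
      p t * conj (p t) - 12 * κ * ((‖z t + 1‖ : ℂ)⁻¹ + (‖z t - 1‖ : ℂ)⁻¹) + 3 * (w t : ℂ) ^ 2
        = E := by
  refine exists_eq_of_hasDerivAt_zero hIo hIc fun t ht => ?_
  refine ((((h.hasDerivAt_p t ht).fun_mul (h.hasDerivAt_conj_p ht)).fun_sub
    (((h.hasDerivAt_inv_norm_add_one ht).fun_add (h.hasDerivAt_inv_norm_sub_one ht)).const_mul
      (12 * κ : ℂ))).fun_add
    (((h.hasDerivAt_w t ht).fun_pow 2).const_mul (3 : ℂ))).congr_deriv ?_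
  push_cast
  ring

theorem rigidity_deriv (h : IsRigidPairMotion I κ z p w) (hκ : κ ≠ 0) (hIo : IsOpen I) {t : ℝ}
    (ht : t ∈ I) (ρ : ℂ) (hρ : ρ = (‖z t + 1‖ : ℂ) * (‖z t - 1‖ : ℂ)⁻¹) :
    6 * Complex.I * w t * (1 - ρ ^ 3) * (z t - conj (z t)) * ((z t + 1) * (conj (z t) + 1)) =
    -3 * (p t * (conj (z t) + 1) + conj (p t) * (z t + 1)
      - Complex.I * w t * (z t - conj (z t))) * ((z t + 1) + (conj (z t) + 1))
    + 3 * ρ ^ 5 * (p t * (conj (z t) - 1) + conj (p t) * (z t - 1)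
      + Complex.I * w t * (z t - conj (z t))) * ((z t - 1) + (conj (z t) - 1))
    + 2 * (1 - ρ ^ 3) * ((z t + 1) * (conj (z t) + 1)) * (p t + conj (p t)) := by
  have hz := h.hasDerivAt_z t ht
  have hzb := h.hasDerivAt_conj_z ht
  have hA := (h.hasDerivAt_inv_norm_add_one ht).fun_pow 3
  have hB := (h.hasDerivAt_inv_norm_sub_one ht).fun_pow 3
  have hL := (h.hasDerivAt_w t ht).fun_pow 2
  have hR := (((((hA.fun_mul (hz.add_const 1)).fun_add (hA.fun_mul (hzb.add_const 1))).const_add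
    1).fun_sub ((hB.fun_mul (hz.sub_const 1)).fun_add
      (hB.fun_mul (hzb.sub_const 1))))).const_mul (κ : ℂ)
  -- The constraint holds near `t`, so its two sides have the same derivative. Division by `κ` and
  -- multiplication by `r ^ 5` then leave the distances only through the ratio `ρ`.
  have key := hL.unique (hR.congr_of_eventuallyEq
    (Filter.mem_of_superset (hIo.mem_nhds ht) h.rigidity))
  have hκ' : (κ : ℂ) ≠ 0 := by exact_mod_cast hκ
  have hr := norm_add_one_sq (z t)
  have hu := mul_inv_cancel₀ (h.norm_add_one_ne ht)
  generalize (‖z t + 1‖ : ℂ)⁻¹ = u at *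
  generalize (‖z t - 1‖ : ℂ)⁻¹ = v at *
  generalize (‖z t + 1‖ : ℂ) = r at *
  generalize conj (z t) = zb at *
  generalize conj (p t) = pb at *
  have key2 := mul_left_cancel₀ hκ' (b := 4 * Complex.I * w t * (u ^ 3 - v ^ 3) * (z t - zb))
    (c := -3 * u ^ 5 * (p t * (zb + 1) + pb * (z t + 1) - Complex.I * w t * (z t - zb)) *
      ((z t + 1) + (zb + 1)) + 3 * v ^ 5 * (p t * (zb - 1) + pb * (z t - 1)
      + Complex.I * w t * (z t - zb)) * ((z t - 1) + (zb - 1)) + 2 * (u ^ 3 - v ^ 3) *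
      (p t + pb - Complex.I * w t * (z t - zb))) (by
        push_cast at key
        linear_combination 2 * key)
  have h3 : u ^ 3 * r ^ 5 = (z t + 1) * (zb + 1) := by
    rw [← hr]; linear_combination r ^ 2 * ((r * u) ^ 2 + r * u + 1) * hu
  have h5 : u ^ 5 * r ^ 5 = 1 := by rw [← mul_pow, mul_comm, hu, one_pow]
  have h3' : v ^ 3 * r ^ 5 = ρ ^ 3 * ((z t + 1) * (zb + 1)) := by
    rw [← hr, hρ]; ring
  have h5' : v ^ 5 * r ^ 5 = ρ ^ 5 := by rw [hρ]; ring
  linear_combination r ^ 5 * key2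
    - (6 * Complex.I * w t * (z t - zb) - 2 * (p t + pb)) * (h3 - h3')
    - 3 * (p t * (zb + 1) + pb * (z t + 1) - Complex.I * w t * (z t - zb)) *
      ((z t + 1) + (zb + 1)) * h5 + 3 * (p t * (zb - 1) + pb * (z t - 1)
      + Complex.I * w t * (z t - zb)) * ((z t - 1) + (zb - 1)) * h5'

end IsRigidPairMotion

end Motion

/-! ### Constancy of the relative position -/

section Motion

open ComplexConjugate

namespace IsRigidPairMotion

variable {I : Set ℝ} {κ : ℝ} {z p : ℝ → ℂ} {w : ℝ → ℝ}

set_option maxHeartbeats 2000000 in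
/-- The jet of a motion with a rigid pair in a field into which the functions on `I` are mapped. -/
theorem exists_jet (h : IsRigidPairMotion I κ z p w) (hκ : κ ≠ 0) (hIo : IsOpen I)
    (hIc : IsPreconnected I) {K : Type*} [Field K] (φ : (ℝ → ℂ) →+* K)
    (hφ : ∀ f g : ℝ → ℂ, (∀ t ∈ I, f t = g t) → φ f = φ g) (hinv : ∀ f, φ f⁻¹ = (φ f)⁻¹) :
    ∃ (D : RigidPairJet K) (L E : ℂ), D.z.fst = φ z ∧ D.κ = φ (fun _ => (κ : ℂ)) ∧
      D.L = φ (fun _ => L) ∧ D.E = φ (fun _ => E) := by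
  obtain ⟨L, hL⟩ := h.exists_angular_momentum_eq hIo hIc
  obtain ⟨E, hE⟩ := h.exists_energy_eq hIo hIc
  have jet := @mapRingHom_eq_of_mem_jetSubring I hIo K _ φ hφ
  obtain ⟨zb, hzb⟩ : ∃ zb : ℝ → ℂ, zb = fun t => conj (z t) := ⟨_, rfl⟩
  obtain ⟨pb, hpb⟩ : ∃ pb : ℝ → ℂ, pb = fun t => conj (p t) := ⟨_, rfl⟩
  obtain ⟨W, hW⟩ : ∃ W : ℝ → ℂ, W = fun t => (w t : ℂ) := ⟨_, rfl⟩
  obtain ⟨r, hr⟩ : ∃ r : ℝ → ℂ, r = fun t => (‖z t + 1‖ : ℂ) := ⟨_, rfl⟩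
  obtain ⟨s, hs⟩ : ∃ s : ℝ → ℂ, s = fun t => (‖z t - 1‖ : ℂ) := ⟨_, rfl⟩
  obtain ⟨J, hJ⟩ : ∃ J : ℝ → ℂ, J = fun _ => Complex.I := ⟨_, rfl⟩
  obtain ⟨k, hk⟩ : ∃ k : ℝ → ℂ, k = fun _ => (κ : ℂ) := ⟨_, rfl⟩
  have hr0 : ∀ t ∈ I, r t ≠ 0 := fun t ht => by simpa [hr] using h.add_one_ne t ht
  have hs0 : ∀ t ∈ I, s t ≠ 0 := fun t ht => by simpa [hs] using h.sub_one_ne t ht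
  let Z : DualNumber (ℝ → ℂ) := inl z + inr (p - J * W * z)
  let Zb : DualNumber (ℝ → ℂ) := inl zb + inr (pb + J * W * zb)
  let P : DualNumber (ℝ → ℂ) := inl p +
    inr (-(J * W * p) - 6 * k * (r⁻¹ ^ 3 * (z + 1) + s⁻¹ ^ 3 * (z - 1)))
  let Pb : DualNumber (ℝ → ℂ) := inl pb +
    inr (J * W * pb - 6 * k * (r⁻¹ ^ 3 * (zb + 1) + s⁻¹ ^ 3 * (zb - 1)))
  let WW : DualNumber (ℝ → ℂ) := inl W + inr (J * k * ((r⁻¹ ^ 3 - s⁻¹ ^ 3) * (z - zb)))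
  let JJ : DualNumber (ℝ → ℂ) := inl J
  have mJ : JJ ∈ jetSubring I := fun t ht => by
    simpa [JJ, hJ] using! hasDerivAt_const t Complex.I
  have mZ : Z ∈ jetSubring I := mem_jetSubring fun t ht => by
    simpa [hJ, hW] using h.hasDerivAt_z t ht
  have mZb : Zb ∈ jetSubring I := mem_jetSubring fun t ht => by
    simpa [hJ, hW, hzb, hpb] using h.hasDerivAt_conj_z ht
  have mP : P ∈ jetSubring I := mem_jetSubring fun t ht => by
    simpa [hJ, hW, hk, hr, hs] using h.hasDerivAt_p t ht
  have mPb : Pb ∈ jetSubring I := mem_jetSubring fun t ht => by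
    simpa [hJ, hW, hk, hr, hs, hzb, hpb] using h.hasDerivAt_conj_p ht
  have mW : WW ∈ jetSubring I := mem_jetSubring fun t ht => by
    simpa [hJ, hW, hk, hr, hs, hzb] using h.hasDerivAt_w t ht
  -- No formula for this derivative is needed: the jet of `ρ` enters only through `ρ_sq` and
  -- `rigidity_deriv`.
  obtain ⟨ρ', hρ'⟩ : ∃ ρ' : ℝ → ℂ, ∀ t ∈ I, HasDerivAt (r * s⁻¹) (ρ' t) t := by
    refine ⟨fun t => deriv (r * s⁻¹) t, fun t ht => ?_⟩
    rw [hr, hs]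
    exact ((h.hasDerivAt_norm_add_one ht).differentiableAt.mul
      (h.hasDerivAt_inv_norm_sub_one ht).differentiableAt).hasDerivAt
  let R : DualNumber (ℝ → ℂ) := inl (r * s⁻¹) + inr ρ'
  have mR : R ∈ jetSubring I := mem_jetSubring hρ'
  have n := fun (n : ℕ) [n.AtLeastTwo] => ofNat_mem (jetSubring I) n
  have m1 := (jetSubring I).one_mem
  have ne : ∀ f : ℝ → ℂ, (∀ t ∈ I, f t ≠ 0) → φ f ≠ 0 := fun f hf h0 => by
    have h1 := hφ (f * f⁻¹) 1 fun t ht => mul_inv_cancel₀ (hf t ht)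
    simp [h0] at h1
  have h3 : φ 3 = 3 := map_ofNat φ 3
  have h6 : φ 6 = 6 := map_ofNat φ 6
  have h12 : φ 12 = 12 := map_ofNat φ 12
  let M := DualNumber.mapRingHom φ
  refine ⟨{ j := φ J, κ := φ k, L := φ fun _ => L, E := φ fun _ => E, r := φ r, s := φ s,
            z := M Z, zb := M Zb, p := M P, pb := M Pb, w := M WW, ρ := M R
            j_sq := ?_, r_ne := ne _ hr0, s_ne := ne _ hs0, r_sq := ?_, s_sq := ?_, ρ_sq := ?_
            z_snd := ?_, zb_snd := ?_, p_snd := ?_, pb_snd := ?_, w_snd := ?_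
            angular_momentum := ?_, energy := ?_, rigidity := ?_, rigidity_deriv := ?_ },
    L, E, ?_, by simp [hk], rfl, rfl⟩
  · have := hφ (J ^ 2) (-1) fun t ht => by simp [hJ]
    simpa using this
  · have := hφ (r ^ 2) ((z + 1) * (zb + 1)) fun t ht => by
      simpa [hr, hzb] using norm_add_one_sq (z t)
    simpa [M, Z, Zb] using this
  · have := hφ (s ^ 2) ((z - 1) * (zb - 1)) fun t ht => by
      simpa [hs, hzb] using norm_sub_one_sq (z t)
    simpa [M, Z, Zb] using this
  · have := jet (mul_mem (pow_mem mR 2) (mul_mem (sub_mem mZ m1) (sub_mem mZb m1)))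
      (mul_mem (add_mem mZ m1) (add_mem mZb m1)) fun t ht => by
        have h1 := norm_add_one_sq (z t)
        have h2 := norm_sub_one_sq (z t)
        have h3 := h.norm_sub_one_ne ht
        simp [R, Z, Zb, hzb, mul_pow]
        rw [← h2, ← h1, hr]
        simp only [hs]
        field_simp
    simpa only [map_mul, map_add, map_sub, map_pow, map_one] using this
  · simp [M, Z, WW, P]
  · simp [M, Zb, WW, Pb]
  · simp [M, Z, WW, P, hinv, h6]
  · simp [M, Zb, WW, Pb, hinv, h6]
  · simp [M, Z, Zb, WW, hinv]
  · have := hφ (zb * p - z * pb + 6 * J * W) (fun _ => L) fun t ht => by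
      simpa [hzb, hpb, hJ, hW] using hL t ht
    simpa [M, Z, Zb, P, Pb, WW, h6] using this
  · have := hφ (p * pb - 12 * k * (r⁻¹ + s⁻¹) + 3 * W ^ 2) (fun _ => E) fun t ht => by
      simpa [hpb, hk, hr, hs, hW] using hE t ht
    simpa [M, P, Pb, WW, hinv, h3, h12] using this
  · have := hφ (W ^ 2) (k * (1 + (r⁻¹ ^ 3 * (z + 1) + r⁻¹ ^ 3 * (zb + 1))
      - (s⁻¹ ^ 3 * (z - 1) + s⁻¹ ^ 3 * (zb - 1)))) fun t ht => by
      simpa [hzb, hk, hr, hs, hW] using h.rigidity t ht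
    simpa [M, Z, Zb, WW, hinv] using this
  · have := jet (x := 6 * JJ * WW * (1 - R ^ 3) * (Z - Zb) * ((Z + 1) * (Zb + 1)))
      (y := -3 * (P * (Zb + 1) + Pb * (Z + 1) - JJ * WW * (Z - Zb)) * ((Z + 1) + (Zb + 1))
        + 3 * R ^ 5 * (P * (Zb - 1) + Pb * (Z - 1) + JJ * WW * (Z - Zb)) * ((Z - 1) + (Zb - 1))
        + 2 * (1 - R ^ 3) * ((Z + 1) * (Zb + 1)) * (P + Pb)) ?_ ?_ ?_
    · simpa only [map_mul, map_add, map_sub, map_pow, map_one, map_neg, map_ofNat, JJ,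
        DualNumber.mapRingHom_inl] using this
    · exact mul_mem (mul_mem (mul_mem (mul_mem (mul_mem (n 6) mJ) mW) (sub_mem m1 (pow_mem mR 3)))
        (sub_mem mZ mZb)) (mul_mem (add_mem mZ m1) (add_mem mZb m1))
    · exact add_mem (add_mem
        (mul_mem (mul_mem (neg_mem (n 3)) (sub_mem (add_mem (mul_mem mP (add_mem mZb m1))
          (mul_mem mPb (add_mem mZ m1))) (mul_mem (mul_mem mJ mW) (sub_mem mZ mZb))))
          (add_mem (add_mem mZ m1) (add_mem mZb m1)))
        (mul_mem (mul_mem (mul_mem (n 3) (pow_mem mR 5)) (add_mem (add_mem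
          (mul_mem mP (sub_mem mZb m1)) (mul_mem mPb (sub_mem mZ m1)))
          (mul_mem (mul_mem mJ mW) (sub_mem mZ mZb)))) (add_mem (sub_mem mZ m1) (sub_mem mZb m1))))
        (mul_mem (mul_mem (mul_mem (n 2) (sub_mem m1 (pow_mem mR 3)))
          (mul_mem (add_mem mZ m1) (add_mem mZb m1))) (add_mem mP mPb))
    · intro t ht
      simpa [JJ, WW, R, Z, Zb, P, Pb, hJ, hW, hzb, hpb] using
        h.rigidity_deriv hκ hIo ht (r t * (s t)⁻¹) (by rw [hr, hs])
  · simp [M, Z]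

/-- In a motion with a rigid pair the third body rests relative to the pair. -/
theorem exists_z_eq (h : IsRigidPairMotion I κ z p w) (hκ : κ ≠ 0) (hIo : IsOpen I)
    (hIc : IsPreconnected I) : ∃ c, ∀ t ∈ I, z t = c := by
  by_contra hc
  have hinf : (z '' I).Infinite := by
    refine (hIc.image z fun t ht =>
      (h.hasDerivAt_z t ht).continuousAt.continuousWithinAt).infinite_of_nontrivial ?_
    by_contra hn
    have hss := Set.not_nontrivial_iff.1 hn
    rcases I.eq_empty_or_nonempty with hI | ⟨t₀, ht₀⟩
    · exact hc ⟨0, by simp [hI]⟩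
    · exact hc ⟨z t₀, fun t ht => hss (Set.mem_image_of_mem z ht) (Set.mem_image_of_mem z ht₀)⟩
  obtain ⟨K, _, φ, V, hφ, hinv, hV, hzV⟩ := exists_place_of_infinite_image hinf
  obtain ⟨D, L, E, hDz, hDκ, hDL, hDE⟩ := h.exists_jet hκ hIo hIc φ hφ hinv
  let c : ℂ →+* V :=
    (φ.comp (Pi.constRingHom ℝ ℂ)).codRestrict V.toSubring fun a => hV a
  let c' : ℂ →+* IsLocalRing.ResidueField V := (IsLocalRing.residue V).comp c
  -- The constants embed `ℂ` in the residue field; the same embedding keeps the residue of `κ`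
  -- nonzero.
  have : CharZero (IsLocalRing.ResidueField V) := charZero_of_injective_ringHom c'.injective
  have hκV : SpecializesTo V D.κ (c' κ) := by
    rw [hDκ]; exact ⟨hV _, rfl⟩
  refine hzV (hDz ▸ D.z_fst_mem hκV ?_ (hDL ▸ hV L) (hDE ▸ hV E))
  rw [map_ne_zero]
  exact_mod_cast hκ

end IsRigidPairMotion

end Motion

end RigidPairs

/-! ### Classification of the positions of rest -/

section Motion

open ComplexConjugate

/-- The positions of rest relative to the rigid pair. -/
theorem eq_of_rest_real {x : ℝ} (h1 : x + 1 ≠ 0) (h2 : x - 1 ≠ 0)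
    (h : x * (1 + |x + 1|⁻¹ ^ 3 * (2 * (x + 1)) - |x - 1|⁻¹ ^ 3 * (2 * (x - 1))) =
      6 * (|x + 1|⁻¹ ^ 3 * (x + 1) + |x - 1|⁻¹ ^ 3 * (x - 1))) : x = 0 ∨ x = 3 ∨ x = -3 := by
  rcases lt_or_gt_of_ne h1 with h1' | h1' <;> rcases lt_or_gt_of_ne h2 with h2' | h2'
  · rw [abs_of_neg h1', abs_of_neg h2'] at h
    field_simp at h
    right; right
    -- Euler's quintic for equal masses; the quartic factor is positive for negative `x`.
    have h3 : (x + 3) * (x ^ 4 - 3 * x ^ 3 + 7 * x ^ 2 - x + 4) = 0 := by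
      linear_combination h
    rcases mul_eq_zero.1 h3 with h3 | h3
    · linarith
    · have hx : 0 < -x := by linarith
      have := pow_pos hx 3
      nlinarith [sq_nonneg x, sq_nonneg (x ^ 2)]
  · rw [abs_of_neg h1', abs_of_pos h2'] at h
    linarith
  · rw [abs_of_pos h1', abs_of_neg h2'] at h
    field_simp at h
    left
    have h3 : x * ((x + 1) ^ 2 * (x - 1) ^ 2 + 2 * (x - 1) ^ 2 + 2 * (x + 1) ^ 2 + 24) = 0 := by
      linear_combination h
    rcases mul_eq_zero.1 h3 with h3 | h3
    · exact h3
    · have : 0 < (x + 1) ^ 2 * (x - 1) ^ 2 + 2 * (x - 1) ^ 2 + 2 * (x + 1) ^ 2 + 24 := by positivity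
      linarith
  · rw [abs_of_pos h1', abs_of_pos h2'] at h
    field_simp at h
    right; left
    have h3 : (x - 3) * (x ^ 4 + 3 * x ^ 3 + 7 * x ^ 2 + x + 4) = 0 := by
      linear_combination h
    rcases mul_eq_zero.1 h3 with h3 | h3
    · linarith
    · have hx : 0 < x := by linarith
      have : 0 < x ^ 4 + 3 * x ^ 3 + 7 * x ^ 2 + x + 4 := by positivity
      linarith

/-- Off the axis, the absence of torque on the pair forces equal distances, hence `c.re = 0`, and
the transverse balance fixes the distance as `2`. On the axis the balance is Euler's equation. -/
theorem eq_of_rest {c : ℂ} {W : ℝ} (h1 : c + 1 ≠ 0) (h2 : c - 1 ≠ 0)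
    (hG : (‖c + 1‖⁻¹ ^ 3 - ‖c - 1‖⁻¹ ^ 3) * c.im = 0)
    (hW : W = 1 + ‖c + 1‖⁻¹ ^ 3 * (2 * (c.re + 1)) - ‖c - 1‖⁻¹ ^ 3 * (2 * (c.re - 1)))
    (hx : W * c.re = 6 * (‖c + 1‖⁻¹ ^ 3 * (c.re + 1) + ‖c - 1‖⁻¹ ^ 3 * (c.re - 1)))
    (hy : W * c.im = 6 * (‖c + 1‖⁻¹ ^ 3 + ‖c - 1‖⁻¹ ^ 3) * c.im) :
    (c = 0 ∨ c = 3 ∨ c = -3) ∨ (‖c + 1‖ = 2 ∧ ‖c - 1‖ = 2) := by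
  have hr : 0 < ‖c + 1‖ := norm_pos_iff.2 h1
  have hs : 0 < ‖c - 1‖ := norm_pos_iff.2 h2
  by_cases hi : c.im = 0
  · left
    obtain ⟨x, rfl⟩ : ∃ x : ℝ, c = x := ⟨c.re, Complex.ext (by simp) (by simp [hi])⟩
    have e1 : ‖(x : ℂ) + 1‖ = |x + 1| := by
      rw [← Complex.ofReal_one, ← Complex.ofReal_add, Complex.norm_real, Real.norm_eq_abs]
    have e2 : ‖(x : ℂ) - 1‖ = |x - 1| := by
      rw [← Complex.ofReal_one, ← Complex.ofReal_sub, Complex.norm_real, Real.norm_eq_abs]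
    simp only [e1, e2, Complex.ofReal_re] at hW hx
    have := eq_of_rest_real (x := x) (by exact_mod_cast h1) (by exact_mod_cast h2)
      (by rw [← hx, hW]; ring)
    exact_mod_cast this
  · have hAB : ‖c + 1‖⁻¹ ^ 3 = ‖c - 1‖⁻¹ ^ 3 := sub_eq_zero.1 ((mul_eq_zero.1 hG).resolve_right hi)
    have hrs : ‖c + 1‖ = ‖c - 1‖ := by
      rw [pow_left_inj₀ (by positivity) (by positivity) (by norm_num)] at hAB
      exact inv_injective hAB
    have hre : c.re = 0 := by
      have e1 := Complex.sq_norm (c + 1)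
      have e2 := Complex.sq_norm (c - 1)
      rw [hrs, e2] at e1
      simp [Complex.normSq_apply] at e1
      linarith
    right
    have hW' := mul_right_cancel₀ hi hy
    rw [hW, hAB, hre] at hW'
    have h8 : ‖c - 1‖⁻¹ ^ 3 = (2⁻¹ : ℝ) ^ 3 := by linarith
    rw [pow_left_inj₀ (by positivity) (by positivity) (by norm_num)] at h8
    have := inv_injective h8
    exact ⟨hrs.trans this, this⟩

namespace IsRigidPairMotion

variable {I : Set ℝ} {κ : ℝ} {z p : ℝ → ℂ} {w : ℝ → ℝ}

/-- A motion with a rigid pair is a relative equilibrium. -/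
theorem exists_rest (h : IsRigidPairMotion I κ z p w) (hκ : κ ≠ 0) (hIo : IsOpen I)
    (hIc : IsPreconnected I) (hne : I.Nonempty) :
    ∃ (c : ℂ) (ω : ℝ), (∀ t ∈ I, z t = c ∧ w t = ω) ∧
      ((c = 0 ∨ c = 3 ∨ c = -3) ∨ (‖c + 1‖ = 2 ∧ ‖c - 1‖ = 2)) := by
  obtain ⟨c, hc⟩ := h.exists_z_eq hκ hIo hIc
  have hκ' : (κ : ℂ) ≠ 0 := by exact_mod_cast hκ
  obtain ⟨t₀, ht₀⟩ := hne
  obtain ⟨g, hg⟩ : ∃ g, g = Complex.I * κ *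
    (((‖c + 1‖ : ℂ)⁻¹ ^ 3 - (‖c - 1‖ : ℂ)⁻¹ ^ 3) * (c - conj c)) := ⟨_, rfl⟩
  have hw : ∀ t ∈ I, HasDerivAt (fun t => (w t : ℂ)) g t := fun t ht => by
    rw [hg, ← hc t ht]; exact h.hasDerivAt_w t ht
  have hconst : ∀ {f : ℝ → ℂ} {a f' : ℂ} {t : ℝ}, t ∈ I → (∀ t ∈ I, f t = a) →
      HasDerivAt f f' t → f' = 0 := fun {f a f' t} ht ha hf =>
    hf.unique ((hasDerivAt_const t a).congr_of_eventuallyEq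
      (Filter.mem_of_superset (hIo.mem_nhds ht) ha))
  have hsq : ∀ t ∈ I, (w t : ℂ) ^ 2 = (w t₀ : ℂ) ^ 2 := fun t ht => by
    rw [h.rigidity t ht, h.rigidity t₀ ht₀, hc t ht, hc t₀ ht₀]
  -- Both `w ^ 2` and the derivative `g` of `w` are constant, so `2 * w * g = 0`; a nonzero `g`
  -- would make `w` vanish identically.
  have hg0 : g = 0 := by
    by_contra hg0
    have hw0 : ∀ t ∈ I, (w t : ℂ) = 0 := fun t ht => by
      have := hconst ht hsq ((hw t ht).fun_pow 2)
      simpa [hg0] using this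
    exact hg0 (hconst ht₀ hw0 (hw t₀ ht₀))
  obtain ⟨W, hW⟩ := exists_eq_of_hasDerivAt_zero hIo hIc fun t ht => hg0 ▸ hw t ht
  have hWω : ∀ t ∈ I, w t = w t₀ := fun t ht => by
    have := (hW t ht).trans (hW t₀ ht₀).symm
    exact_mod_cast this
  refine ⟨c, w t₀, fun t ht => ⟨hc t ht, hWω t ht⟩, ?_⟩
  have hp : ∀ t ∈ I, p t = Complex.I * w t₀ * c := fun t ht => by
    have := hconst ht hc (h.hasDerivAt_z t ht)
    rw [hc t ht, hWω t ht] at this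
    exact sub_eq_zero.1 this
  have hp' := hconst ht₀ hp (h.hasDerivAt_p t₀ ht₀)
  rw [hp t₀ ht₀] at hp'
  have hE := h.rigidity t₀ ht₀
  rw [hc t₀ ht₀] at hp' hE
  have h1 := h.add_one_ne t₀ ht₀
  have h2 := h.sub_one_ne t₀ ht₀
  rw [hc t₀ ht₀] at h1 h2
  have key : (w t₀ : ℂ) ^ 2 * c = 6 * κ *
      ((‖c + 1‖ : ℂ)⁻¹ ^ 3 * (c + 1) + (‖c - 1‖ : ℂ)⁻¹ ^ 3 * (c - 1)) := by
    linear_combination hp' + (w t₀ : ℂ) ^ 2 * c * Complex.I_sq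
  have hG : ((‖c + 1‖⁻¹ ^ 3 - ‖c - 1‖⁻¹ ^ 3) * c.im : ℝ) = 0 := by
    rw [hg0, Complex.sub_conj] at hg
    have hg' := hg.symm
    simp only [mul_eq_zero, Complex.I_ne_zero, hκ', false_or] at hg'
    rcases hg' with hg' | hg'
    · have : ‖c + 1‖⁻¹ ^ 3 - ‖c - 1‖⁻¹ ^ 3 = 0 := by exact_mod_cast hg'
      rw [this, zero_mul]
    · simp at hg'
      rw [hg', mul_zero]
  have hE' : w t₀ ^ 2 = κ * (1 + ‖c + 1‖⁻¹ ^ 3 * (2 * (c.re + 1))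
      - ‖c - 1‖⁻¹ ^ 3 * (2 * (c.re - 1))) := by
    have e := Complex.add_conj c
    have : (w t₀ : ℂ) ^ 2 = κ * (1 + (‖c + 1‖ : ℂ)⁻¹ ^ 3 * (2 * (c.re + 1))
      - (‖c - 1‖ : ℂ)⁻¹ ^ 3 * (2 * (c.re - 1))) := by
      rw [hE]
      push_cast at e
      linear_combination κ * ((‖c + 1‖ : ℂ)⁻¹ ^ 3 - (‖c - 1‖ : ℂ)⁻¹ ^ 3) * e
    exact_mod_cast this
  have kre := congrArg Complex.re key
  have kim := congrArg Complex.im key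
  have e1 : ((‖c + 1‖ : ℂ)⁻¹ ^ 3) = ((‖c + 1‖⁻¹ ^ 3 : ℝ) : ℂ) := by push_cast; rfl
  have e2 : ((‖c - 1‖ : ℂ)⁻¹ ^ 3) = ((‖c - 1‖⁻¹ ^ 3 : ℝ) : ℂ) := by push_cast; rfl
  have e3 : (w t₀ : ℂ) ^ 2 = ((w t₀ ^ 2 : ℝ) : ℂ) := by push_cast; rfl
  have e4 : (6 * κ : ℂ) = ((6 * κ : ℝ) : ℂ) := by push_cast; rfl
  rw [e1, e2, e3, e4] at kre kim
  rw [Complex.re_ofReal_mul, Complex.re_ofReal_mul, Complex.add_re, Complex.re_ofReal_mul,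
    Complex.re_ofReal_mul] at kre
  rw [Complex.im_ofReal_mul, Complex.im_ofReal_mul, Complex.add_im, Complex.im_ofReal_mul,
    Complex.im_ofReal_mul] at kim
  simp only [Complex.add_re, Complex.sub_re, Complex.add_im, Complex.sub_im, Complex.one_re,
    Complex.one_im, add_zero, sub_zero] at kre kim
  rw [hE'] at kre kim
  refine eq_of_rest h1 h2 hG rfl (mul_left_cancel₀ hκ ?_) (mul_left_cancel₀ hκ ?_)
  · linear_combination kre
  · linear_combination kim

end IsRigidPairMotion

end Motion

/-! ### From three bodies to the frame of the pair and back -/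

section Bodies

open ComplexConjugate

/-- Three bodies of mass `m` in the complex plane, with velocities `v₁`, `v₂`, `v₃`, the first two
of which keep the distance `2 * d`. -/
structure IsThreeBodyWithRigidPair (I : Set ℝ) (m d : ℝ) (f₁ f₂ f₃ v₁ v₂ v₃ : ℝ → ℂ) : Prop where
  d_pos : 0 < d
  norm_sub : ∀ t ∈ I, ‖f₂ t - f₁ t‖ = 2 * d
  ne₁ : ∀ t ∈ I, f₃ t - f₁ t ≠ 0
  ne₂ : ∀ t ∈ I, f₃ t - f₂ t ≠ 0
  hasDerivAt_f₁ : ∀ t ∈ I, HasDerivAt f₁ (v₁ t) t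
  hasDerivAt_f₂ : ∀ t ∈ I, HasDerivAt f₂ (v₂ t) t
  hasDerivAt_f₃ : ∀ t ∈ I, HasDerivAt f₃ (v₃ t) t
  hasDerivAt_v₁ : ∀ t ∈ I, HasDerivAt v₁ ((m / (2 * d) ^ 3) * (f₂ t - f₁ t)
    + (m / ‖f₃ t - f₁ t‖ ^ 3) * (f₃ t - f₁ t)) t
  hasDerivAt_v₂ : ∀ t ∈ I, HasDerivAt v₂ (-((m / (2 * d) ^ 3) * (f₂ t - f₁ t))
    + (m / ‖f₃ t - f₂ t‖ ^ 3) * (f₃ t - f₂ t)) t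
  hasDerivAt_v₃ : ∀ t ∈ I, HasDerivAt v₃ (-((m / ‖f₃ t - f₁ t‖ ^ 3) * (f₃ t - f₁ t))
    - (m / ‖f₃ t - f₂ t‖ ^ 3) * (f₃ t - f₂ t)) t

namespace IsThreeBodyWithRigidPair

variable {I : Set ℝ} {m d : ℝ} {f₁ f₂ f₃ v₁ v₂ v₃ : ℝ → ℂ}

/-- In the frame of the rigid pair, `X` being its direction and `X'` the derivative of `X`. -/
theorem exists_isRigidPairMotion (h : IsThreeBodyWithRigidPair I m d f₁ f₂ f₃ v₁ v₂ v₃)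
    (hIo : IsOpen I) :
    ∃ (X z p : ℝ → ℂ) (w : ℝ → ℝ), IsRigidPairMotion I (m / (4 * d ^ 3)) z p w ∧
      ∀ t ∈ I, ‖X t‖ = 1 ∧ HasDerivAt X (Complex.I * w t * X t) t ∧
        f₂ t - f₁ t = 2 * d * X t ∧ f₃ t - (f₁ t + f₂ t) / 2 = d * X t * z t := by
  have hd := h.d_pos
  have hd0 : (d : ℂ) ≠ 0 := by exact_mod_cast hd.ne'
  obtain ⟨X, hX⟩ : ∃ X : ℝ → ℂ, X = fun t => (f₂ t - f₁ t) / (2 * d) := ⟨_, rfl⟩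
  obtain ⟨X₁, hX₁⟩ : ∃ X₁ : ℝ → ℂ, X₁ = fun t => (v₂ t - v₁ t) / (2 * d) := ⟨_, rfl⟩
  obtain ⟨y, hy⟩ : ∃ y : ℝ → ℂ, y = fun t => (f₃ t - (f₁ t + f₂ t) / 2) / d := ⟨_, rfl⟩
  obtain ⟨y₁, hy₁⟩ : ∃ y₁ : ℝ → ℂ, y₁ = fun t => (v₃ t - (v₁ t + v₂ t) / 2) / d := ⟨_, rfl⟩
  obtain ⟨z, hz⟩ : ∃ z : ℝ → ℂ, z = fun t => y t * conj (X t) := ⟨_, rfl⟩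
  obtain ⟨p, hp⟩ : ∃ p : ℝ → ℂ, p = fun t => y₁ t * conj (X t) := ⟨_, rfl⟩
  obtain ⟨w, hw⟩ : ∃ w : ℝ → ℝ, w = fun t => (-Complex.I * X₁ t * conj (X t)).re := ⟨_, rfl⟩
  have dX : ∀ t ∈ I, HasDerivAt X (X₁ t) t := fun t ht => by
    rw [hX, hX₁]; exact ((h.hasDerivAt_f₂ t ht).sub (h.hasDerivAt_f₁ t ht)).div_const _
  have dy : ∀ t ∈ I, HasDerivAt y (y₁ t) t := fun t ht => by
    rw [hy, hy₁]
    exact ((h.hasDerivAt_f₃ t ht).sub (((h.hasDerivAt_f₁ t ht).add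
      (h.hasDerivAt_f₂ t ht)).div_const _)).div_const _
  have nX : ∀ t ∈ I, ‖X t‖ = 1 := fun t ht => by
    rw [hX]
    simp only [norm_div, h.norm_sub t ht, norm_mul, Complex.norm_real, Complex.norm_ofNat,
      Real.norm_eq_abs, abs_of_pos hd]
    field_simp
  have XX : ∀ t ∈ I, X t * conj (X t) = 1 := fun t ht => by
    rw [Complex.mul_conj, Complex.normSq_eq_norm_sq, nX t ht]; simp
  have dXX : ∀ t ∈ I, X₁ t * conj (X t) + X t * conj (X₁ t) = 0 := fun t ht =>
    ((dX t ht).fun_mul (dX t ht).star).unique ((hasDerivAt_const t (1 : ℂ)).congr_of_eventuallyEq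
      (Filter.mem_of_superset (hIo.mem_nhds ht) XX))
  have hwc : ∀ t ∈ I, (w t : ℂ) = -Complex.I * X₁ t * conj (X t) := fun t ht => by
    rw [hw]
    refine Complex.conj_eq_iff_re.1 ?_
    simp only [map_mul, map_neg, Complex.conj_I, Complex.conj_conj]
    linear_combination Complex.I * dXX t ht
  have hX₁w : ∀ t ∈ I, X₁ t = Complex.I * w t * X t := fun t ht => by
    rw [hwc t ht]
    linear_combination -X₁ t * XX t ht + X₁ t * X t * conj (X t) * Complex.I_sq
  have hXf : ∀ t, f₂ t - f₁ t = 2 * d * X t := fun t => by rw [hX]; field_simp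
  have hyz : ∀ t ∈ I, y t = X t * z t := fun t ht => by
    rw [hz]; linear_combination -y t * XX t ht
  have hf3 : ∀ t ∈ I, f₃ t - (f₁ t + f₂ t) / 2 = d * X t * z t := fun t ht => by
    rw [mul_assoc, ← hyz t ht, hy]; field_simp
  have h31 : ∀ t ∈ I, f₃ t - f₁ t = d * X t * (z t + 1) := fun t ht => by
    linear_combination hf3 t ht + hXf t / 2
  have h32 : ∀ t ∈ I, f₃ t - f₂ t = d * X t * (z t - 1) := fun t ht => by
    linear_combination hf3 t ht - hXf t / 2
  have n31 : ∀ t ∈ I, (‖f₃ t - f₁ t‖ : ℂ) = d * ‖z t + 1‖ := fun t ht => by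
    rw [h31 t ht, norm_mul, norm_mul, nX t ht, Complex.norm_real, Real.norm_eq_abs,
      abs_of_pos hd]
    push_cast; ring
  have n32 : ∀ t ∈ I, (‖f₃ t - f₂ t‖ : ℂ) = d * ‖z t - 1‖ := fun t ht => by
    rw [h32 t ht, norm_mul, norm_mul, nX t ht, Complex.norm_real, Real.norm_eq_abs,
      abs_of_pos hd]
    push_cast; ring
  have ne1 : ∀ t ∈ I, z t + 1 ≠ 0 := fun t ht h0 => h.ne₁ t ht (by rw [h31 t ht, h0, mul_zero])
  have ne2 : ∀ t ∈ I, z t - 1 ≠ 0 := fun t ht h0 => h.ne₂ t ht (by rw [h32 t ht, h0, mul_zero])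
  -- The pair's mutual attraction changes `X` at the rate `-2 * m / (2 * d) ^ 3 = -κ`. The third
  -- body's acceleration relative to the midpoint carries `3 / 2 * m / d ^ 3 = 6 * κ`.
  obtain ⟨κ, hκ⟩ : ∃ κ : ℝ, κ = m / (4 * d ^ 3) := ⟨_, rfl⟩
  have hκ' : (κ : ℂ) = m / (4 * d ^ 3) := by rw [hκ]; push_cast; rfl
  have dX₁ : ∀ t ∈ I, HasDerivAt X₁ (-κ * X t * (1 + 2 * ((‖z t + 1‖ : ℂ)⁻¹ ^ 3 * (z t + 1))
      - 2 * ((‖z t - 1‖ : ℂ)⁻¹ ^ 3 * (z t - 1)))) t := fun t ht => by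
    rw [hX₁]
    refine (((h.hasDerivAt_v₂ t ht).sub (h.hasDerivAt_v₁ t ht)).div_const _).congr_deriv ?_
    rw [n31 t ht, n32 t ht, h31 t ht, h32 t ht, hXf t, hκ']
    have := norm_ne_zero_iff.2 (ne1 t ht)
    have := norm_ne_zero_iff.2 (ne2 t ht)
    generalize ‖z t + 1‖ = r at *
    generalize ‖z t - 1‖ = s at *
    field_simp
    ring
  have dy₁ : ∀ t ∈ I, HasDerivAt y₁ (-6 * κ * X t * ((‖z t + 1‖ : ℂ)⁻¹ ^ 3 * (z t + 1)
      + (‖z t - 1‖ : ℂ)⁻¹ ^ 3 * (z t - 1))) t := fun t ht => by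
    rw [hy₁]
    refine (((h.hasDerivAt_v₃ t ht).sub (((h.hasDerivAt_v₁ t ht).add
      (h.hasDerivAt_v₂ t ht)).div_const _)).div_const _).congr_deriv ?_
    rw [n31 t ht, n32 t ht, h31 t ht, h32 t ht, hXf t, hκ']
    have := norm_ne_zero_iff.2 (ne1 t ht)
    have := norm_ne_zero_iff.2 (ne2 t ht)
    generalize ‖z t + 1‖ = r at *
    generalize ‖z t - 1‖ = s at *
    field_simp
    ring
  have dcX : ∀ t ∈ I, HasDerivAt (fun t => conj (X t)) (-Complex.I * w t * conj (X t)) t :=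
    fun t ht => (dX t ht).star.congr_deriv (by rw [hX₁w t ht]; simp)
  have dw : ∀ t ∈ I, HasDerivAt (fun t => (w t : ℂ)) (-Complex.I * (w t ^ 2 -
      κ * (1 + 2 * ((‖z t + 1‖ : ℂ)⁻¹ ^ 3 * (z t + 1))
      - 2 * ((‖z t - 1‖ : ℂ)⁻¹ ^ 3 * (z t - 1))))) t := fun t ht => by
    refine ((((dX₁ t ht).const_mul (-Complex.I)).fun_mul (dcX t ht)).congr_of_eventuallyEq
      (Filter.mem_of_superset (hIo.mem_nhds ht) hwc)).congr_deriv ?_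
    rw [hX₁w t ht]
    linear_combination (Complex.I * κ * (1 + 2 * ((‖z t + 1‖ : ℂ)⁻¹ ^ 3 * (z t + 1))
      - 2 * ((‖z t - 1‖ : ℂ)⁻¹ ^ 3 * (z t - 1))) - Complex.I * w t ^ 2) * XX t ht
      + Complex.I * w t ^ 2 * X t * conj (X t) * Complex.I_sq
  -- Since `w` is real, its derivative equals its own conjugate; this is the radial part of the
  -- pair's equation of motion.
  have rig : ∀ t ∈ I, (w t : ℂ) ^ 2 = κ * (1 +
      ((‖z t + 1‖ : ℂ)⁻¹ ^ 3 * (z t + 1) + (‖z t + 1‖ : ℂ)⁻¹ ^ 3 * (conj (z t) + 1))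
      - ((‖z t - 1‖ : ℂ)⁻¹ ^ 3 * (z t - 1) + (‖z t - 1‖ : ℂ)⁻¹ ^ 3 * (conj (z t) - 1))) :=
    fun t ht => by
      have h1 := (dw t ht).unique ((dw t ht).star.congr_of_eventuallyEq
        (Filter.Eventually.of_forall fun t => by simp))
      simp at h1
      have h2 := mul_left_cancel₀ Complex.I_ne_zero
        (b := 2 * (w t : ℂ) ^ 2) (c := 2 * (κ * (1 +
      ((‖z t + 1‖ : ℂ)⁻¹ ^ 3 * (z t + 1) + (‖z t + 1‖ : ℂ)⁻¹ ^ 3 * (conj (z t) + 1))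
      - ((‖z t - 1‖ : ℂ)⁻¹ ^ 3 * (z t - 1) + (‖z t - 1‖ : ℂ)⁻¹ ^ 3 * (conj (z t) - 1)))))
        (by simp only [inv_pow]; linear_combination -h1)
      linear_combination h2 / 2
  refine ⟨X, z, p, w, ?_, fun t ht => ⟨nX t ht, hX₁w t ht ▸ dX t ht, hXf t, hf3 t ht⟩⟩
  rw [← hκ]
  refine ⟨ne1, ne2, fun t ht => ?_, fun t ht => ?_, fun t ht => ?_, rig⟩
  · have := (dy t ht).fun_mul (dcX t ht)
    rw [hz, hp]
    refine this.congr_deriv ?_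
    ring
  · have := (dy₁ t ht).fun_mul (dcX t ht)
    rw [hp]
    refine this.congr_deriv ?_
    linear_combination (-6 * κ * ((‖z t + 1‖ : ℂ)⁻¹ ^ 3 * (z t + 1)
      + (‖z t - 1‖ : ℂ)⁻¹ ^ 3 * (z t - 1))) * XX t ht
  · refine (dw t ht).congr_deriv ?_
    linear_combination -Complex.I * rig t ht

/-- Three equal masses two of which keep their distance are in relative equilibrium. -/
theorem exists_uniform_rotation (h : IsThreeBodyWithRigidPair I m d f₁ f₂ f₃ v₁ v₂ v₃)
    (hm : 0 < m) (hIo : IsOpen I) (hIc : IsPreconnected I) (hne : I.Nonempty) :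
    ∃ (a b : ℂ) (ω : ℝ) (P₁ P₂ P₃ : ℂ), P₁ + P₂ + P₃ = 0 ∧ P₁ ≠ P₂ ∧ P₁ ≠ P₃ ∧ P₂ ≠ P₃ ∧
      ((‖P₁ - P₂‖ = ‖P₁ - P₃‖ ∧ ‖P₁ - P₂‖ = ‖P₂ - P₃‖) ∨
        P₁ + P₂ = 2 * P₃ ∨ P₁ + P₃ = 2 * P₂ ∨ P₂ + P₃ = 2 * P₁) ∧
      ∀ t ∈ I, f₁ t = a + t * b + Complex.exp ((ω * t : ℝ) * Complex.I) * P₁ ∧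
        f₂ t = a + t * b + Complex.exp ((ω * t : ℝ) * Complex.I) * P₂ ∧
        f₃ t = a + t * b + Complex.exp ((ω * t : ℝ) * Complex.I) * P₃ := by
  have hd := h.d_pos
  have hd0 : (d : ℂ) ≠ 0 := by exact_mod_cast hd.ne'
  obtain ⟨X, z, p, w, hmot, hX⟩ := h.exists_isRigidPairMotion hIo
  have hκ : m / (4 * d ^ 3) ≠ 0 := by positivity
  obtain ⟨c, ω, hcω, hc⟩ := hmot.exists_rest hκ hIo hIc hne
  obtain ⟨b, hb⟩ := exists_eq_of_hasDerivAt_zero hIo hIc (f := fun t => (v₁ t + v₂ t + v₃ t) / 3)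
    fun t ht => ((((h.hasDerivAt_v₁ t ht).add (h.hasDerivAt_v₂ t ht)).add
      (h.hasDerivAt_v₃ t ht)).div_const 3).congr_deriv (by ring)
  obtain ⟨a, ha⟩ := exists_eq_of_hasDerivAt_zero hIo hIc
    (f := fun t => (f₁ t + f₂ t + f₃ t) / 3 - t * b) fun t ht =>
      (((((h.hasDerivAt_f₁ t ht).add (h.hasDerivAt_f₂ t ht)).add
        (h.hasDerivAt_f₃ t ht)).div_const 3).sub
        ((hasDerivAt_id t).ofReal_comp.mul_const b)).congr_deriv (by
          rw [← hb t ht]; simp)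
  have dexp : ∀ t : ℝ, HasDerivAt (fun t : ℝ => Complex.exp (-((ω * t : ℝ) * Complex.I)))
      (Complex.exp (-((ω * t : ℝ) * Complex.I)) * (-(ω * Complex.I))) t := fun t => by
    refine (((hasDerivAt_id t).const_mul ω).ofReal_comp.mul_const Complex.I).neg.cexp.congr_deriv ?_
    simp
  obtain ⟨X₀, hX₀⟩ := exists_eq_of_hasDerivAt_zero hIo hIc
    (f := fun t => X t * Complex.exp (-((ω * t : ℝ) * Complex.I))) fun t ht =>
      ((hX t ht).2.1.fun_mul (dexp t)).congr_deriv (by rw [(hcω t ht).2]; ring)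
  have hXe : ∀ t ∈ I, X t = Complex.exp ((ω * t : ℝ) * Complex.I) * X₀ := fun t ht => by
    rw [← hX₀ t ht, mul_left_comm, ← Complex.exp_add, add_neg_cancel, Complex.exp_zero, mul_one]
  obtain ⟨t₀, ht₀⟩ := hne
  have hX00 : X₀ ≠ 0 := fun h0 => by
    have := (hX t₀ ht₀).1
    rw [hXe t₀ ht₀, h0] at this
    simp at this
  have h1 := hmot.add_one_ne t₀ ht₀
  have h2 := hmot.sub_one_ne t₀ ht₀
  rw [(hcω t₀ ht₀).1] at h1 h2
  have hdX : (d : ℂ) * X₀ ≠ 0 := mul_ne_zero hd0 hX00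
  -- In units of `d * X₀` the bodies are at `-1`, `1`, `c`, and the centre of mass `c / 3` is
  -- subtracted.
  refine ⟨a, b, ω, d * X₀ * (-1 - c / 3), d * X₀ * (1 - c / 3), d * X₀ * (2 * c / 3), by ring,
    fun h0 => ?_, fun h0 => h1 ?_, fun h0 => h2 ?_, ?_, fun t ht => ?_⟩
  · have := mul_left_cancel₀ hdX h0
    have h20 : (2 : ℂ) = 0 := by linear_combination -this
    norm_num at h20
  · linear_combination -mul_left_cancel₀ hdX h0
  · linear_combination -mul_left_cancel₀ hdX h0
  · rcases hc with (rfl | rfl | rfl) | ⟨hr, hs⟩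
    · right; left; ring
    · right; right; left; ring
    · right; right; right; ring
    · left
      have e1 : (d : ℂ) * X₀ * (-1 - c / 3) - d * X₀ * (1 - c / 3) = d * X₀ * (-2) := by ring
      have e2 : (d : ℂ) * X₀ * (-1 - c / 3) - d * X₀ * (2 * c / 3) = d * X₀ * (-(c + 1)) := by ring
      have e3 : (d : ℂ) * X₀ * (1 - c / 3) - d * X₀ * (2 * c / 3) = d * X₀ * (-(c - 1)) := by ring
      rw [e1, e2, e3]
      simp only [norm_mul (_ * X₀), norm_neg, hr, hs]
      simp
  · obtain ⟨-, -, h21, h3⟩ := hX t ht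
    rw [(hcω t ht).1, hXe t ht] at h3
    rw [hXe t ht] at h21
    have ha := ha t ht
    refine ⟨?_, ?_, ?_⟩
    · linear_combination ha - h21 / 2 - h3 / 3
    · linear_combination ha + h21 / 2 - h3 / 3
    · linear_combination ha + 2 * h3 / 3

end IsThreeBodyWithRigidPair

end Bodies

/-! ### Transfer to the Euclidean plane and conclusion -/

/-- The identification of the complex plane with the Euclidean plane. -/
noncomputable def complexToPlane : ℂ ≃ₗᵢ[ℝ] EuclideanSpace ℝ (Fin 2) :=
  Complex.orthonormalBasisOneI.repr

theorem planeRotation_complexToPlane (θ : ℝ) (z : ℂ) :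
    planeRotation θ (complexToPlane z) =
      complexToPlane (Complex.exp ((θ : ℝ) * Complex.I) * z) := by
  ext i
  fin_cases i <;>
    simp [planeRotation, complexToPlane, Complex.exp_ofReal_mul_I_re, Complex.exp_ofReal_mul_I_im]
  ring

theorem dist_planeRotation (θ : ℝ) (p p' : EuclideanSpace ℝ (Fin 2)) :
    dist (planeRotation θ p) (planeRotation θ p') = dist p p' := by
  obtain ⟨z, rfl⟩ := complexToPlane.surjective p
  obtain ⟨z', rfl⟩ := complexToPlane.surjective p'
  rw [planeRotation_complexToPlane, planeRotation_complexToPlane, LinearIsometryEquiv.dist_map,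
    LinearIsometryEquiv.dist_map, dist_eq_norm, dist_eq_norm, ← mul_sub, norm_mul,
    Complex.norm_exp_ofReal_mul_I, one_mul]

theorem IsLagrangeMotion.isRelativeEquilibrium {I : Set ℝ}
    {q : Fin 3 → ℝ → EuclideanSpace ℝ (Fin 2)} (h : IsLagrangeMotion I q) :
    IsRelativeEquilibrium I q := by
  obtain ⟨a, b, ω, p, -, -, hq⟩ := h
  intro i j _
  refine ⟨dist (p i) (p j), fun t ht => ?_⟩
  rw [hq t ht, hq t ht, dist_add_left, dist_planeRotation]

theorem isSymmetricCollinear_of_add_eq {w : Fin 3 → ℂ} {i j k : Fin 3} (hij : i ≠ j) (hik : i ≠ k)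
    (hw : w j ≠ w k) (h : w j + w k = 2 * w i) :
    IsSymmetricCollinear (fun l => complexToPlane (w l)) := by
  refine ⟨i, j, k, hij, hik, fun h' => hw (complexToPlane.injective h'), ?_⟩
  have : w i = midpoint ℝ (w j) (w k) := by
    rw [midpoint_eq_smul_add, h]
    simp
  simp only [this, midpoint_eq_smul_add, map_smul, map_add]

/-- An empty interval imposes nothing on the motion, but an admissible configuration must still be
exhibited. -/
theorem isLagrangeMotion_empty (q : Fin 3 → ℝ → EuclideanSpace ℝ (Fin 2)) :
    IsLagrangeMotion ∅ q := by
  refine ⟨0, 0, 0, fun l => complexToPlane (![0, 1, -1] l), ?_, Or.inr ?_, by simp⟩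
  · rw [← map_sum]
    simp [Fin.sum_univ_three]
  · refine isSymmetricCollinear_of_add_eq (w := ![0, 1, -1]) (i := 0) (j := 1) (k := 2)
      (by decide) (by decide) ?_ ?_
    · simp [Complex.ext_iff]
      norm_num
    · simp

theorem IsNBodySolution.isThreeBodyWithRigidPair {m : ℝ} {I : Set ℝ}
    {q : Fin 3 → ℝ → EuclideanSpace ℝ (Fin 2)} (hq : IsNBodySolution (fun _ => m) I q)
    (hne : I.Nonempty) {i j k : Fin 3} (hij : i ≠ j) (hik : i ≠ k) (hjk : j ≠ k)
    (hc : HasConstantDistance I q i j) :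
    ∃ (d : ℝ) (v : Fin 3 → ℝ → ℂ), IsThreeBodyWithRigidPair I m d
      (fun t => complexToPlane.symm (q i t)) (fun t => complexToPlane.symm (q j t))
      (fun t => complexToPlane.symm (q k t)) (v i) (v j) (v k) := by
  obtain ⟨c, hc⟩ := hc
  obtain ⟨v, hv⟩ := hq.newton
  have hcpos : 0 < c := by
    obtain ⟨t, ht⟩ := hne
    rw [← hc t ht]
    exact dist_pos.2 (hq.no_collision t ht i j hij)
  have hsub : ∀ l l' t, complexToPlane.symm (q l t) - complexToPlane.symm (q l' t) =
      complexToPlane.symm (q l t - q l' t) := fun l l' t => (map_sub _ _ _).symm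
  have hnorm : ∀ l l' t, ‖complexToPlane.symm (q l t) - complexToPlane.symm (q l' t)‖ =
      ‖q l t - q l' t‖ := fun l l' t => by
    rw [hsub, LinearIsometryEquiv.norm_map]
  have hji : ∀ t ∈ I, ‖q j t - q i t‖ = 2 * (c / 2) := fun t ht => by
    rw [← dist_eq_norm, dist_comm, hc t ht]
    ring
  have hderiv : ∀ {f : ℝ → EuclideanSpace ℝ (Fin 2)} {f' : EuclideanSpace ℝ (Fin 2)} {t : ℝ},
      HasDerivAt f f' t →
      HasDerivAt (fun s => complexToPlane.symm (f s)) (complexToPlane.symm f') t := by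
    intro f f' t hf
    exact (complexToPlane.symm.toContinuousLinearEquiv.hasFDerivAt (x := f t)).comp_hasDerivAt t hf
  have hsmul : ∀ (r : ℝ) x, complexToPlane.symm (r • x) = (r : ℂ) * complexToPlane.symm x :=
    fun r x => by rw [map_smul, Complex.real_smul]
  have herase : ∀ a b c : Fin 3, a ≠ b → a ≠ c → b ≠ c → Finset.univ.erase a = {b, c} := by
    decide
  refine ⟨c / 2, fun l t => complexToPlane.symm (v l t), ?_⟩
  have hacc : ∀ {a b c : Fin 3}, a ≠ b → a ≠ c → b ≠ c → ∀ t ∈ I,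
      HasDerivAt (fun s => complexToPlane.symm (v a s))
        (((m / ‖q b t - q a t‖ ^ 3 : ℝ) : ℂ) *
            (complexToPlane.symm (q b t) - complexToPlane.symm (q a t)) +
          ((m / ‖q c t - q a t‖ ^ 3 : ℝ) : ℂ) *
            (complexToPlane.symm (q c t) - complexToPlane.symm (q a t))) t := by
    intro a b c hab hac hbc t ht
    have := hderiv (hv t ht a).2
    rwa [herase a b c hab hac hbc, Finset.sum_pair hbc, map_add, hsmul, hsmul, ← hsub,
      ← hsub] at this
  refine ⟨by positivity, fun t ht => by rw [hnorm, hji t ht], fun t ht => ?_, fun t ht => ?_,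
    fun t ht => hderiv (hv t ht i).1, fun t ht => hderiv (hv t ht j).1,
    fun t ht => hderiv (hv t ht k).1, fun t ht => ?_, fun t ht => ?_, fun t ht => ?_⟩
  · rw [sub_ne_zero]
    exact fun h => hq.no_collision t ht i k hik (complexToPlane.symm.injective h).symm
  · rw [sub_ne_zero]
    exact fun h => hq.no_collision t ht j k hjk (complexToPlane.symm.injective h).symm
  · convert hacc hij hik hjk t ht using 1
    rw [hnorm, hji t ht]
    push_cast
    ring
  · convert hacc hij.symm hjk hik t ht using 1
    rw [hnorm, norm_sub_rev (q i t), hji t ht]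
    push_cast
    ring
  · convert hacc hik.symm hjk.symm hij t ht using 1
    rw [hnorm, hnorm, norm_sub_rev (q i t), norm_sub_rev (q j t)]
    push_cast
    ring

theorem IsNBodySolution.isLagrangeMotion {m : ℝ} (hm : 0 < m) {I : Set ℝ} (hIo : IsOpen I)
    (hIc : I.OrdConnected) {q : Fin 3 → ℝ → EuclideanSpace ℝ (Fin 2)}
    (hq : IsNBodySolution (fun _ => m) I q) {i j : Fin 3} (hij : i ≠ j)
    (hc : HasConstantDistance I q i j) : IsLagrangeMotion I q := by
  rcases I.eq_empty_or_nonempty with rfl | hne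
  · exact isLagrangeMotion_empty q
  obtain ⟨k, hik, hjk, hcases⟩ : ∃ k, i ≠ k ∧ j ≠ k ∧ ∀ l, l = i ∨ l = j ∨ l = k := by
    clear hc
    revert i j
    decide
  obtain ⟨d, v, h⟩ := hq.isThreeBodyWithRigidPair hne hij hik hjk hc
  obtain ⟨a, b, ω, P₁, P₂, P₃, hsum, h₁₂, h₁₃, h₂₃, hshape, hmotion⟩ :=
    h.exists_uniform_rotation hm hIo hIc.isPreconnected hne
  obtain ⟨w, hwi, hwj, hwk⟩ : ∃ w : Fin 3 → ℂ, w i = P₁ ∧ w j = P₂ ∧ w k = P₃ :=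
    ⟨fun l => if l = i then P₁ else if l = j then P₂ else P₃, by simp, by simp [hij.symm],
      by simp [hik.symm, hjk.symm]⟩
  refine ⟨complexToPlane a, complexToPlane b, ω, fun l => complexToPlane (w l), ?_, ?_, ?_⟩
  · have huniv : (Finset.univ : Finset (Fin 3)) = {i, j, k} := by
      ext l
      simpa using hcases l
    rw [← map_sum, huniv, Finset.sum_insert (by simp [hij, hik]), Finset.sum_pair hjk, hwi, hwj,
      hwk, ← add_assoc, hsum, map_zero]
  · rcases hshape with ⟨h₁, h₂⟩ | h' | h' | h'
    · refine Or.inl ⟨‖P₁ - P₂‖, norm_pos_iff.2 (sub_ne_zero.2 h₁₂), fun l l' hll => ?_⟩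
      rw [LinearIsometryEquiv.dist_map, dist_eq_norm]
      rcases hcases l with rfl | rfl | rfl <;> rcases hcases l' with rfl | rfl | rfl <;>
        first
        | exact absurd rfl hll
        | simp only [hwi, hwj, hwk, norm_sub_rev P₂ P₁, norm_sub_rev P₃ P₁, norm_sub_rev P₃ P₂,
            ← h₁, ← h₂]
    · exact Or.inr (isSymmetricCollinear_of_add_eq hik.symm hjk.symm (by rwa [hwi, hwj])
        (by rwa [hwi, hwj, hwk]))
    · exact Or.inr (isSymmetricCollinear_of_add_eq hij.symm hjk (by rwa [hwi, hwk])
        (by rwa [hwi, hwj, hwk]))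
    · exact Or.inr (isSymmetricCollinear_of_add_eq hij hik (by rwa [hwj, hwk])
        (by rwa [hwi, hwj, hwk]))
  · intro t ht l
    obtain ⟨hi, hj, hk⟩ := hmotion t ht
    have key : complexToPlane.symm (q l t) =
        a + t * b + Complex.exp ((ω * t : ℝ) * Complex.I) * w l := by
      rcases hcases l with rfl | rfl | rfl
      · rw [hi, hwi]
      · rw [hj, hwj]
      · rw [hk, hwk]
    rw [planeRotation_complexToPlane, ← complexToPlane.apply_symm_apply (q l t), key, map_add,
      map_add, ← Complex.real_smul, map_smul]

theorem theorem1 (m : ℝ) (hm : 0 < m) (I : Set ℝ) (hIo : IsOpen I) (hIc : I.OrdConnected)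
    (q : Fin 3 → ℝ → EuclideanSpace ℝ (Fin 2)) (hq : IsNBodySolution (fun _ => m) I q) :
    ¬ IsPartiallyRigid I q ∧
    ((∃ i j, i ≠ j ∧ HasConstantDistance I q i j) →
      IsRelativeEquilibrium I q ∧ IsLagrangeMotion I q) := by
  have key : (∃ i j, i ≠ j ∧ HasConstantDistance I q i j) →
      IsRelativeEquilibrium I q ∧ IsLagrangeMotion I q := by
    rintro ⟨i, j, hij, hc⟩
    have h := hq.isLagrangeMotion hm hIo hIc hij hc
    exact ⟨h.isRelativeEquilibrium, h⟩
  exact ⟨fun h => h.2 (key h.1).1, key⟩
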